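/- Let $d\ge 1$, and let $\mathbb T^d$ be the $d$-dimensional torus ($\mathbb T=[0,2\pi]$ with end points identified). $L^p(\mathbb T^d)$ carries the norm $\|f\|_p=\big((2\pi)^{-d}\int_{\mathbb T^d}|f|^p\,dx\big)^{1/p}$ (the essential supremum if $p=\infty$), convolution is $(u*v)(x)=(2\pi)^{-d}\int_{\mathbb T^d}u(x-y)v(y)\,dy$, and functions are complex valued (real-valued functions are a special case). Let $1\le p\le\infty$, $1<r<\infty$, $0\le\kappa<\infty$. Let $\lambda:\mathbb R\to\mathbb R\setminus\{0\}$ be a mask of type $(r,\kappa)$: $\lambda$ is even, twice continuously differentiable, and $\lambda(t)=t^{-r}(\log(t+1))^{-\kappa}F(\log t)$ for $t\ge 1$, where $F:\mathbb R\to\mathbb R$ is such that $F,F',F''$ are bounded on $[1,\infty)$. Let $\vartheta:\mathbb R\to\mathbb R$ be twice continuously differentiable, equal to $1$ on $[-\frac12,\frac12]$ and to $0$ outside $(-1,1)$. Put $\varphi_{\lambda,d}(x)=\sum_{j\in\mathbb Z^d}\prod_{l=1}^d\lambda(j_l)\,e^{i(j,x)}$, $\varphi_\lambda=\varphi_{\lambda,1}$,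 and $$\mathcal H_{\lambda,p}(\mathbb T^d)=\{f=\varphi_{\lambda,d}*g:\ g\in L^p(\mathbb T^d)\},\qquad \|f\|_{\mathcal H_{\lambda,p}(\mathbb T^d)}=\|g\|_p .$$ (The functions $\varphi_{\lambda,d}*g$ are continuous, and $g$ is determined by $f$ up to null sets.) For $m\in\mathbb N$ and a univariate $f=\varphi_\lambda*g$ let $$Q_m(f)=\frac1{2m+1}\sum_{s=0}^{2m}(H_m*g)\Big(\frac{2\pi s}{2m+1}\Big)\,\varphi_\lambda\Big(\cdot-\frac{2\pi s}{2m+1}\Big),\qquad H_m(x)=\sum_{k\in\mathbb Z}\vartheta(k/m)e^{ikx}.$$ Put $q_0=Q_1$, $q_k=Q_{2^k}-Q_{2^{k-1}}$ for $k\ge1$, and, for $k\in\mathbb Z_+^d$ (the vectors with non-negative integer coordinates), $q_k=\prod_{j=1}^d q_{k_j}$, where $q_{k_j}$ is applied to $f$ as a function of the variable $x_j$ with the other variables held fixed. Let $|k|=\sum_{j}k_j$. Then every $f\in\mathcal H_{\lambda,p}(\mathbb T^d)$ is the sum of the series $$f=\sum_{k\in\mathbb Z_+^d}q_k(f),$$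 which converges (unconditionally) in $L^p(\mathbb T^d)$. Moreover, there is a constant $C$, independent of $f$ and $k$, such that for all $f\in\mathcal H_{\lambda,p}(\mathbb T^d)$ and all $k\in\mathbb Z^d_+$ $$\|q_k(f)\|_p\le C\,2^{-r|k|}\prod_{j=1}^d(k_j+2)^{-\kappa}\,\|f\|_{\mathcal H_{\lambda,p}(\mathbb T^d)} .$$ -/

import Mathlib

open MeasureTheory Filter Topology
open scoped ENNReal

noncomputable section

namespace TranslateApprox

instance factTwoPiPos : Fact ((0 : ℝ) < 2 * Real.pi) := ⟨Real.two_pi_pos⟩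

/-- The one-dimensional torus, that is, `[0, 2π]` with its end points identified. -/
abbrev Torus : Type := AddCircle (2 * Real.pi)

/-- The normalized measure `dx / (2π)` on the one-dimensional torus. -/
abbrev circleMeasure : Measure Torus := AddCircle.haarAddCircle

/-- The normalized measure `(2π)^{-d} dx` on the `d`-dimensional torus `Fin d → Torus`.
With it, `eLpNorm f p (torusMeasure d)` is `((2π)^{-d} ∫ |f|^p)^{1/p}`, and the essential
supremum of `|f|` for `p = ∞`. -/
def torusMeasure (d : ℕ) : Measure (Fin d → Torus) :=
  Measure.pi fun _ => circleMeasure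

/-- The function `lam` is a mask of type `(r, κ)`: it is even, twice continuously differentiable,
and `lam t = t^{-r} (log (t + 1))^{-κ} F (log t)` for `t ≥ 1`, where `F` and its first two
derivatives are bounded on `[1, ∞)`. (The formula makes `F` twice continuously differentiable on
`(0, ∞)`, so the derivatives below are genuine ones.) -/
structure IsMask (r κ : ℝ) (lam : ℝ → ℝ) : Prop where
  even : ∀ t, lam (-t) = lam t
  contDiff : ContDiff ℝ 2 lam
  exists_profile : ∃ (F : ℝ → ℝ) (a : ℝ),
    (∀ t : ℝ, 1 ≤ t → lam t = t ^ (-r) * Real.log (t + 1) ^ (-κ) * F (Real.log t)) ∧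
    ∀ n : ℕ, n ≤ 2 → ∀ t : ℝ, 1 ≤ t → |iteratedDeriv n F t| ≤ a

/-- A twice continuously differentiable cut-off function, equal to `1` on `[-1/2, 1/2]` and
to `0` outside `(-1, 1)`. -/
structure IsCutoff (θ : ℝ → ℝ) : Prop where
  contDiff : ContDiff ℝ 2 θ
  eq_one : ∀ x ∈ Set.Icc (-(1 / 2) : ℝ) (1 / 2), θ x = 1
  eq_zero : ∀ x ∉ Set.Ioo (-1 : ℝ) 1, θ x = 0

/-- The univariate function `φ_lam x = ∑_{j ∈ ℤ} lam j e^{i j x}`. -/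
def phi (lam : ℝ → ℝ) (x : Torus) : ℂ :=
  ∑' j : ℤ, (lam j : ℂ) * fourier j x

/-- The multivariate function
`φ_{lam, d} x = ∑_{j ∈ ℤ^d} (∏_l lam (j_l)) e^{i (j, x)}`. -/
def phiMulti (d : ℕ) (lam : ℝ → ℝ) (x : Fin d → Torus) : ℂ :=
  ∑' j : Fin d → ℤ, (∏ l, (lam (j l) : ℂ)) * ∏ l, fourier (j l) (x l)

/-- Convolution of complex-valued functions on the one-dimensional torus, with respect to
`dx / (2π)`. -/
def conv (u v : Torus → ℂ) : Torus → ℂ :=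
  convolution u v (ContinuousLinearMap.mul ℂ ℂ) circleMeasure

/-- Convolution of complex-valued functions on the `d`-dimensional torus, with respect to
`(2π)^{-d} dx`. -/
def convMulti {d : ℕ} (u v : (Fin d → Torus) → ℂ) : (Fin d → Torus) → ℂ :=
  convolution u v (ContinuousLinearMap.mul ℂ ℂ) (torusMeasure d)

/-- The space `H_{lam, p}` of all `φ_{lam, d} * g` with `g ∈ L^p`. For the masks considered here
`φ_{lam, d}` is continuous, and the convolution is the continuous representative of its class. -/
def spaceH (d : ℕ) (lam : ℝ → ℝ) (p : ℝ≥0∞) : Set ((Fin d → Torus) → ℂ) :=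
  {f | ∃ g : (Fin d → Torus) → ℂ, MemLp g p (torusMeasure d) ∧ f = convMulti (phiMulti d lam) g}

open Classical in
/-- The norm of `f = φ_{lam, d} * g` in `H_{lam, p}`, namely `‖g‖_p`. If `lam` has no zeros, then
`g` is determined by `f` up to null sets. -/
def normH (d : ℕ) (lam : ℝ → ℝ) (p : ℝ≥0∞) (f : (Fin d → Torus) → ℂ) : ℝ≥0∞ :=
  if h : f ∈ spaceH d lam p then eLpNorm h.choose p (torusMeasure d) else ⊤

open Classical in
/-- An integrable function `g` on the one-dimensional torus with `f = φ_lam * g`, if there is one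
(it is unique up to null sets when `lam` has no zeros), and `0` otherwise. As `L^p ⊆ L^1`, this is
the `g` that represents `f` in the univariate space `H_{lam, p}`, for each `p ≥ 1`. -/
def density (lam : ℝ → ℝ) (f : Torus → ℂ) : Torus → ℂ :=
  if h : ∃ g : Torus → ℂ, Integrable g circleMeasure ∧ f = conv (phi lam) g then h.choose else 0

/-- The trigonometric polynomial `H_m x = ∑_{k ∈ ℤ} θ (k / m) (lam k / β k) e^{i k x}`. -/
def kernelH (θ lam β : ℝ → ℝ) (m : ℕ) (x : Torus) : ℂ :=
  ∑' k : ℤ, ((θ ((k : ℝ) / m) * (lam k / β k) : ℝ) : ℂ) * fourier k x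

/-- The equidistant node `2π s / (2m + 1)`. -/
def node (m s : ℕ) : Torus :=
  ((2 * Real.pi * s / (2 * m + 1) : ℝ) : Torus)

/-- The univariate operator `Q_{m, β}`: for `f = φ_lam * g`,
`Q_{m, β} f x = (2m + 1)⁻¹ ∑_{s = 0}^{2m} (H_m * g) (t_s) φ_β (x - t_s)`
with `t_s = 2π s / (2m + 1)`. -/
def opQ (θ lam β : ℝ → ℝ) (m : ℕ) (f : Torus → ℂ) (x : Torus) : ℂ :=
  (1 / (2 * (m : ℂ) + 1)) * ∑ s ∈ Finset.range (2 * m + 1),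
    conv (kernelH θ lam β m) (density lam f) (node m s) * phi β (x - node m s)

/-- The univariate operators `q_0 = Q_{1, lam}` and `q_k = Q_{2^k, lam} - Q_{2^{k-1}, lam}`
for `k > 0`. -/
def opq (θ lam : ℝ → ℝ) : ℕ → (Torus → ℂ) → Torus → ℂ
  | 0, f => opQ θ lam lam 1 f
  | k + 1, f => opQ θ lam lam (2 ^ (k + 1)) f - opQ θ lam lam (2 ^ k) f

/-- The univariate operator `A` applied to `f` as a function of the variable `x j`, with the other
variables held fixed. -/
def applyAt {d : ℕ} (A : (Torus → ℂ) → Torus → ℂ) (j : Fin d) (f : (Fin d → Torus) → ℂ) :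
    (Fin d → Torus) → ℂ :=
  fun x => A (fun t => f (Function.update x j t)) (x j)

/-- The operator `q_k = ∏_j q_{k_j}`, where `q_{k_j}` acts in the `j`-th variable. -/
def opqMulti {d : ℕ} (θ lam : ℝ → ℝ) (k : Fin d → ℕ) (f : (Fin d → Torus) → ℂ) :
    (Fin d → Torus) → ℂ :=
  (List.finRange d).foldr (fun j h => applyAt (opq θ lam (k j)) j h) f

end TranslateApprox

end

open TranslateApprox

/-! On `φ_λ * g` the operator `opQ` is an integral operator applied to `g`, with kernel `K_m(x,y) =
(2m+1)⁻¹ ∑_s H_m(t_s - y) φ_λ(x - t_s)`, so everything reduces to comparing `K_m` with `φ_λ(x - y)`.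
Split `φ_λ` into a low part with coefficients `λ(j) θ(j/m)` and a high-frequency rest. The
frequencies of `H_m` and of the low part differ by less than `2m+1`, so the average over the nodes
is exact there (`mean_mul_trigSeries`) and produces the coefficients `λ θ²`. The error is therefore
the high part of `φ_λ` for the cut-off `θ²`, minus the node average of `H_m` against the high part
for `θ` (`kernelErr_eq`).

Both terms are controlled through coefficients. If `∑ |a_j| ≤ B m` and the second differences
satisfy `∑ |Δ² a_j| ≤ B / m`, the trigonometric series of `a` is dominated by `2B` times the Poisson
kernel of radius `1 - 1/m` (`norm_trigSeries_le_poisson`). The means of that kernel over translated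
nodes are at most `3` (`mean_poisson_le`), which bounds discrete means and `L¹` norms by `6B`. The
mask condition makes the `i`-th derivative of `λ`, `i ≤ 2`, of order `|t|^{-r-i} (log |t|)^{-κ}` for
large `|t|`; hence the high parts satisfy such bounds with `B` of order `m^{-r} (log (m+2))^{-κ}`
(`IsMask.coeffBound_highPart`). For `k ≥ 1` the kernel of `q_k` is a difference of two error
kernels, so its row and column `L¹` norms decay as claimed (`IsMask.kernelq_bound`).

In `d` variables `q_k(f)` is the integral operator with the product kernel applied to `g`
(`opqMulti_eq_integralOp`), and Schur's test gives the estimate for all `p` at once. For the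
expansion a cruder bound suffices: the sup norm of the univariate kernel of `q_k` is
`O(2^{(1-r)k})`, summable because `r > 1`. The product kernels then sum absolutely and uniformly to
the kernel of `f`, and the partial sums converge uniformly (`IsMask.norm_sub_sum_le`). -/

noncomputable section

namespace TranslateApprox

/-! ### Absolutely convergent trigonometric series -/

/-- The trigonometric series with real coefficients `a`. -/
def trigSeries (a : ℤ → ℝ) (x : Torus) : ℂ := ∑' j : ℤ, (a j : ℂ) * fourier j x

lemma norm_fourier_apply (j : ℤ) (x : Torus) : ‖(fourier j x : ℂ)‖ = 1 := by
  rw [fourier_apply]; exact Circle.norm_coe _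

lemma fourier_add_apply (j : ℤ) (x y : Torus) :
    (fourier j (x + y) : ℂ) = fourier j x * fourier j y := by
  simp only [fourier_apply, smul_add, AddCircle.toCircle_add, Circle.coe_mul]

lemma fourier_neg_apply (j : ℤ) (x : Torus) : (fourier j (-x) : ℂ) = fourier (-j) x := by
  simp only [fourier_apply, smul_neg, neg_smul]

lemma fourier_sub_apply (j : ℤ) (x y : Torus) :
    (fourier j (x - y) : ℂ) = fourier j x * fourier (-j) y := by
  rw [sub_eq_add_neg, fourier_add_apply, fourier_neg_apply]

lemma fourier_eq_pow (n : ℕ) (x : Torus) : (fourier (n : ℤ) x : ℂ) = fourier 1 x ^ n := by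
  induction n with
  | zero => simp
  | succ n ih => rw [Nat.cast_succ, fourier_add, ih, pow_succ]

lemma norm_coeff_mul_fourier (a : ℤ → ℝ) (j : ℤ) (x : Torus) :
    ‖(a j : ℂ) * fourier j x‖ = |a j| := by
  rw [norm_mul, norm_fourier_apply, mul_one, Complex.norm_real, Real.norm_eq_abs]

lemma summable_trigSeries {a : ℤ → ℝ} (ha : Summable fun j => |a j|) (x : Torus) :
    Summable fun j : ℤ => (a j : ℂ) * fourier j x :=
  Summable.of_norm (by simpa only [norm_coeff_mul_fourier] using ha)

lemma norm_trigSeries_le {a : ℤ → ℝ} (ha : Summable fun j => |a j|) (x : Torus) :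
    ‖trigSeries a x‖ ≤ ∑' j, |a j| := by
  have h := norm_tsum_le_tsum_norm (f := fun j : ℤ => (a j : ℂ) * fourier j x)
    (by simpa only [norm_coeff_mul_fourier] using ha)
  simp only [norm_coeff_mul_fourier] at h
  exact h

lemma continuous_trigSeries {a : ℤ → ℝ} (ha : Summable fun j => |a j|) :
    Continuous (trigSeries a) :=
  continuous_tsum (fun j => continuous_const.mul (fourier j).continuous) ha
    fun j x => (norm_coeff_mul_fourier a j x).le

lemma trigSeries_add {a b : ℤ → ℝ} (ha : Summable fun j => |a j|) (hb : Summable fun j => |b j|)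
    (x : Torus) : trigSeries (fun j => a j + b j) x = trigSeries a x + trigSeries b x := by
  unfold trigSeries
  rw [← (summable_trigSeries ha x).tsum_add (summable_trigSeries hb x)]
  exact tsum_congr fun j => by push_cast; ring

lemma trigSeries_const_mul (a : ℤ → ℝ) (c : ℝ) (x : Torus) :
    trigSeries (fun j => c * a j) x = c * trigSeries a x := by
  unfold trigSeries
  rw [← tsum_mul_left]
  exact tsum_congr fun j => by push_cast; ring

lemma trigSeries_shift (a : ℤ → ℝ) (k : ℤ) (x : Torus) :
    trigSeries (fun j => a (j + k)) x = fourier (-k) x * trigSeries a x := by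
  unfold trigSeries
  rw [← tsum_mul_left, ← (Equiv.addRight k).tsum_eq
    (fun j : ℤ => fourier (-k) x * ((a j : ℂ) * fourier j x))]
  refine tsum_congr fun j => ?_
  have h : (fourier j x : ℂ) = fourier (-k) x * fourier (j + k) x := by
    rw [← fourier_add]; congr 2; ring
  simp only [Equiv.coe_addRight]
  rw [h]; ring

lemma summable_shift {a : ℤ → ℝ} (ha : Summable fun j => |a j|) (k : ℤ) :
    Summable fun j => |a (j + k)| :=
  (Equiv.addRight k).summable_iff.2 ha

/-- The second difference of a sequence. -/
def secondDiff (a : ℤ → ℝ) (j : ℤ) : ℝ := a (j + 1) - 2 * a j + a (j - 1)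

lemma summable_secondDiff {a : ℤ → ℝ} (ha : Summable fun j => |a j|) :
    Summable fun j => |secondDiff a j| := by
  refine ((((summable_shift ha 1).add (ha.mul_left 2)).add (summable_shift ha (-1)))).of_nonneg_of_le
    (fun _ => abs_nonneg _) fun j => ?_
  unfold secondDiff
  rw [← sub_eq_add_neg]
  have := abs_add_le (a (j + 1) - 2 * a j) (a (j - 1))
  have h2 := abs_sub (a (j + 1)) (2 * a j)
  rw [abs_mul, abs_of_nonneg (zero_le_two : (0 : ℝ) ≤ 2)] at h2
  linarith

lemma trigSeries_secondDiff {a : ℤ → ℝ} (ha : Summable fun j => |a j|) (x : Torus) :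
    trigSeries (secondDiff a) x = (fourier (-1) x - 2 + fourier 1 x) * trigSeries a x := by
  have h1 : secondDiff a = fun j => (a (j + 1) + (-2) * a j) + a (j + (-1)) := by
    ext j; unfold secondDiff; rw [← sub_eq_add_neg]; ring
  have ha2 : Summable fun j => |(-2) * a j| := by
    simpa only [abs_mul] using ha.mul_left |(-2 : ℝ)|
  have ha3 : Summable fun j => |a (j + 1) + (-2) * a j| :=
    ((summable_shift ha 1).add ha2).of_nonneg_of_le (fun _ => abs_nonneg _)
      fun j => abs_add_le _ _
  rw [h1, trigSeries_add ha3 (summable_shift ha (-1)), trigSeries_add (summable_shift ha 1) ha2,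
    trigSeries_const_mul, trigSeries_shift, trigSeries_shift, neg_neg]
  push_cast; ring

/-! ### The Poisson kernel -/

/-- The Poisson kernel. -/
def poisson (ρ : ℝ) (x : Torus) : ℝ := (1 - ρ ^ 2) / ‖1 - ρ * (fourier 1 x : ℂ)‖ ^ 2

lemma normSq_one_sub_mul {z : ℂ} (hz : ‖z‖ = 1) (ρ : ℝ) :
    ‖1 - ρ * z‖ ^ 2 = (1 - ρ) ^ 2 + ρ * ‖z - 1‖ ^ 2 := by
  have h : z.re ^ 2 + z.im ^ 2 = 1 := by
    have := Complex.sq_norm z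
    rw [hz, Complex.normSq_apply] at this; nlinarith
  rw [Complex.sq_norm, Complex.sq_norm, Complex.normSq_apply, Complex.normSq_apply]
  simp
  linear_combination (ρ ^ 2 - ρ) * h

lemma norm_second_eq {z : ℂ} (hz : ‖z‖ = 1) :
    ‖(starRingEnd ℂ) z - 2 + z‖ = ‖z - 1‖ ^ 2 := by
  have h : z.re ^ 2 + z.im ^ 2 = 1 := by
    have := Complex.sq_norm z
    rw [hz, Complex.normSq_apply] at this; nlinarith
  have h1 : (starRingEnd ℂ) z - 2 + z = ((-(‖z - 1‖ ^ 2) : ℝ) : ℂ) := by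
    rw [Complex.sq_norm, Complex.normSq_apply]
    apply Complex.ext
    · simp
      linear_combination h
    · simp
  rw [h1, Complex.norm_real, norm_neg, Real.norm_eq_abs, abs_of_nonneg (by positivity)]

lemma poisson_neg (ρ : ℝ) (x : Torus) : poisson ρ (-x) = poisson ρ x := by
  unfold poisson
  rw [fourier_neg_apply, fourier_neg]
  congr 2
  rw [← Complex.norm_conj]
  simp

lemma one_sub_mul_ne_zero {z : ℂ} (hz : ‖z‖ = 1) {ρ : ℝ} (h0 : 0 ≤ ρ) (h1 : ρ < 1) :
    1 - ρ * z ≠ 0 := by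
  intro h
  have : ‖(ρ : ℂ) * z‖ = 1 := by rw [← sub_eq_zero.1 h]; simp
  rw [norm_mul, hz, mul_one, Complex.norm_real, Real.norm_eq_abs, abs_of_nonneg h0] at this
  linarith

lemma summable_pow_natAbs {ρ : ℝ} (h0 : 0 ≤ ρ) (h1 : ρ < 1) :
    Summable fun j : ℤ => |ρ ^ j.natAbs| := by
  have hg := hasSum_geometric_of_lt_one h0 h1
  refine (HasSum.of_nat_of_neg_add_one (f := fun j : ℤ => |ρ ^ j.natAbs|)
    (m := (1 - ρ)⁻¹) (m' := ρ * (1 - ρ)⁻¹) ?_ ?_).summable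
  · simpa [abs_of_nonneg h0] using hg
  · have e : (fun n : ℕ => |ρ ^ (-((n : ℤ) + 1)).natAbs|) = fun n => ρ * ρ ^ n := by
      funext n
      rw [abs_of_nonneg (by positivity), Int.natAbs_neg, ← pow_succ']
      norm_cast
    rw [e]; exact hg.mul_left ρ

lemma trigSeries_pow_natAbs {ρ : ℝ} (h0 : 0 ≤ ρ) (h1 : ρ < 1) (x : Torus) :
    trigSeries (fun j => ρ ^ j.natAbs) x = (poisson ρ x : ℂ) := by
  have hz := norm_fourier_apply 1 x
  set z : ℂ := fourier 1 x with hzdef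
  have hn : ∀ w : ℂ, ‖w‖ = 1 → HasSum (fun n : ℕ => (ρ * w) ^ n) (1 - ρ * w)⁻¹ := fun w hw =>
    hasSum_geometric_of_norm_lt_one (by
      rw [norm_mul, hw, mul_one, Complex.norm_real, Real.norm_eq_abs, abs_of_nonneg h0]; exact h1)
  have hz' : ‖(starRingEnd ℂ) z‖ = 1 := by rw [Complex.norm_conj, hz]
  have key : HasSum (fun j : ℤ => (((ρ ^ j.natAbs : ℝ)) : ℂ) * fourier j x)
      ((1 - ρ * z)⁻¹ + ρ * (starRingEnd ℂ) z * (1 - ρ * (starRingEnd ℂ) z)⁻¹) := by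
    refine HasSum.of_nat_of_neg_add_one ?_ ?_
    · convert hn z hz using 2 with n
      rw [fourier_eq_pow, Int.natAbs_natCast, mul_pow]; push_cast; rfl
    · have e : (fun n : ℕ => ((ρ ^ (-((n : ℤ) + 1)).natAbs : ℝ) : ℂ) * fourier (-((n : ℤ) + 1)) x) =
          fun n => ρ * (starRingEnd ℂ) z * (ρ * (starRingEnd ℂ) z) ^ n := by
        funext n
        rw [← pow_succ', mul_pow, fourier_neg, Int.natAbs_neg]
        have : ((n : ℤ) + 1) = ((n + 1 : ℕ) : ℤ) := by push_cast; ring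
        rw [this, fourier_eq_pow, Int.natAbs_natCast, map_pow]; push_cast; rfl
      rw [e]; exact (hn _ hz').mul_left (ρ * (starRingEnd ℂ) z)
  rw [trigSeries, key.tsum_eq]
  have hne := one_sub_mul_ne_zero hz h0 h1
  have hne' := one_sub_mul_ne_zero hz' h0 h1
  have hsq : ((‖1 - ρ * z‖ ^ 2 : ℝ) : ℂ) = (1 - ρ * z) * (1 - ρ * (starRingEnd ℂ) z) := by
    have := Complex.mul_conj (1 - ρ * z)
    rw [Complex.normSq_eq_norm_sq] at this
    rw [← this]; simp
  have hzz : z * (starRingEnd ℂ) z = 1 := by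
    rw [Complex.mul_conj, Complex.normSq_eq_norm_sq, hz]; norm_num
  rw [poisson, Complex.ofReal_div, hsq]
  rw [eq_div_iff (mul_ne_zero hne hne')]
  field_simp
  push_cast
  linear_combination (-(ρ : ℂ) ^ 2) * hzz

/-- Taking second differences multiplies the series by a factor of modulus `|z - 1|²`, where `z =
e^{ix}`. The hypotheses thus bound both `|u|` and `|z - 1|² |u|`, and `ε² + (1 - ε) |z - 1|²` with
`ε = 1/m` is exactly the denominator of the Poisson kernel of radius `1 - ε`. -/
lemma norm_trigSeries_le_poisson {a : ℤ → ℝ} (ha : Summable fun j => |a j|) {B : ℝ} {m : ℕ}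
    (hm : 1 ≤ m) (h0 : ∑' j, |a j| ≤ B * m) (h2 : ∑' j, |secondDiff a j| ≤ B / m) (x : Torus) :
    ‖trigSeries a x‖ ≤ 2 * B * poisson (1 - 1 / m) x := by
  have hm' : (1 : ℝ) ≤ m := by exact_mod_cast hm
  have hz := norm_fourier_apply 1 x
  have hB : 0 ≤ B := by
    have : 0 ≤ B * m := (tsum_nonneg fun j => abs_nonneg (a j)).trans h0
    exact nonneg_of_mul_nonneg_left this (by linarith)
  have hu := (norm_trigSeries_le ha x).trans h0
  have hu2 : ‖(fourier 1 x : ℂ) - 1‖ ^ 2 * ‖trigSeries a x‖ ≤ B / m := by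
    rw [← norm_second_eq hz, ← norm_mul, ← fourier_neg, ← trigSeries_secondDiff ha]
    exact (norm_trigSeries_le (summable_secondDiff ha) x).trans h2
  set ε : ℝ := 1 / m with hε
  have hε0 : 0 < ε := by positivity
  have hε1 : ε ≤ 1 := by rw [hε, div_le_one (by linarith)]; exact hm'
  have hεm : ε * m = 1 := by rw [hε]; field_simp
  have hBm : B / m = B * ε := by rw [hε]; ring
  have hD : 0 < ‖1 - ((1 - ε : ℝ) : ℂ) * (fourier 1 x : ℂ)‖ ^ 2 := by
    have := one_sub_mul_ne_zero hz (ρ := 1 - ε) (by linarith) (by linarith)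
    positivity
  rw [poisson, ← mul_div_assoc, le_div_iff₀ hD, normSq_one_sub_mul hz]
  have e1 : ‖trigSeries a x‖ * ε ^ 2 ≤ B * ε := by
    calc ‖trigSeries a x‖ * ε ^ 2 ≤ (B * m) * ε ^ 2 := by gcongr
      _ = B * ε := by linear_combination (B * ε) * hεm
  have e2 : (1 - ε) * (‖(fourier 1 x : ℂ) - 1‖ ^ 2 * ‖trigSeries a x‖) ≤ B * ε := by
    rw [← hBm]
    refine le_trans (mul_le_of_le_one_left (by positivity) (by linarith)) hu2
  -- The slack: `2B (1 - ρ²) - 2Bε = 2Bε (1 - ε)` for `ρ = 1 - ε`.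
  have e3 : 0 ≤ B * ε * (1 - ε) := by
    have : 0 ≤ 1 - ε := by linarith
    positivity
  nlinarith

/-! ### Means over equidistant nodes -/

lemma fourier_node (m : ℕ) (j : ℤ) (s : ℕ) :
    (fourier j (node m s) : ℂ) = (fourier j (node m 1) : ℂ) ^ s := by
  unfold node
  rw [fourier_coe_apply, fourier_coe_apply, ← Complex.exp_nat_mul]
  congr 1; push_cast; ring

lemma fourier_node_one_eq_one_iff (m : ℕ) (j : ℤ) :
    (fourier j (node m 1) : ℂ) = 1 ↔ (2 * m + 1 : ℤ) ∣ j := by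
  unfold node
  rw [fourier_coe_apply, Complex.exp_eq_one_iff]
  have hN : (2 * (m : ℂ) + 1) ≠ 0 := by exact_mod_cast (Nat.succ_ne_zero (2 * m))
  have hpi : (Real.pi : ℂ) ≠ 0 := by exact_mod_cast Real.pi_ne_zero
  have hI := Complex.I_ne_zero
  constructor
  · rintro ⟨n, hn⟩
    refine ⟨n, ?_⟩
    have : (j : ℂ) = (2 * m + 1) * n := by
      push_cast at hn
      field_simp at hn
      linear_combination hn
    exact_mod_cast this
  · rintro ⟨n, rfl⟩
    refine ⟨n, ?_⟩
    push_cast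
    field_simp

lemma sum_fourier_node (m : ℕ) (j : ℤ) :
    ∑ s ∈ Finset.range (2 * m + 1), (fourier j (node m s) : ℂ) =
      if (2 * m + 1 : ℤ) ∣ j then (2 * m + 1 : ℂ) else 0 := by
  rw [Finset.sum_congr rfl fun s _ => fourier_node m j s]
  split_ifs with h
  · rw [(fourier_node_one_eq_one_iff m j).2 h]
    simp only [one_pow, Finset.sum_const, Finset.card_range, nsmul_eq_mul, mul_one]
    push_cast; rfl
  · have hne : (fourier j (node m 1) : ℂ) ≠ 1 := fun h' => h ((fourier_node_one_eq_one_iff m j).1 h')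
    rw [geom_sum_eq hne, ← fourier_node]
    have : (fourier j (node m (2 * m + 1)) : ℂ) = 1 := by
      have hN : (2 * (m : ℝ) + 1) ≠ 0 := by positivity
      have : node m (2 * m + 1) = 0 := by
        unfold node
        push_cast
        rw [mul_div_assoc, div_self hN, mul_one]
        exact AddCircle.coe_period _
      rw [this, fourier_eval_zero]
    rw [this, sub_self, zero_div]

/-- Aliasing: the average over the nodes keeps only the frequencies divisible by `2m+1`. -/
lemma mean_trigSeries {a : ℤ → ℝ} (ha : Summable fun j => |a j|) (m : ℕ) (y : Torus) :
    (1 / (2 * m + 1) : ℂ) * ∑ s ∈ Finset.range (2 * m + 1), trigSeries a (node m s - y) =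
      ∑' j : ℤ, (if (2 * m + 1 : ℤ) ∣ j then (a j : ℂ) else 0) * fourier (-j) y := by
  have hN : (2 * (m : ℂ) + 1) ≠ 0 := by exact_mod_cast (Nat.succ_ne_zero (2 * m))
  simp_rw [trigSeries]
  rw [← Summable.tsum_finsetSum fun s _ => summable_trigSeries ha _, ← tsum_mul_left]
  refine tsum_congr fun j => ?_
  simp_rw [fourier_sub_apply, ← mul_assoc]
  rw [← Finset.sum_mul, ← Finset.mul_sum, sum_fourier_node]
  split_ifs
  · field_simp
  · simp

lemma one_sub_inv_pow_le (m : ℕ) (hm : 1 ≤ m) : (1 - 1 / (m : ℝ)) ^ (2 * m + 1) ≤ 1 / 2 := by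
  have hm' : (1 : ℝ) ≤ m := by exact_mod_cast hm
  have h1 : 1 / (m : ℝ) ≤ 1 := by rw [div_le_one (by linarith)]; exact hm'
  have h2 : 0 < 1 / (m : ℝ) := by positivity
  calc (1 - 1 / (m : ℝ)) ^ (2 * m + 1) ≤ (1 - 1 / (m : ℝ)) ^ m :=
        pow_le_pow_of_le_one (by linarith) (by linarith) (by omega)
    _ ≤ Real.exp (-1) := Real.one_sub_div_pow_le_exp_neg hm'
    _ ≤ 1 / 2 := by
        rw [Real.exp_neg, one_div]
        exact inv_anti₀ (by norm_num) (by linarith [Real.add_one_le_exp 1])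

/-- Only the coefficients `ρ^|j|` with `2m+1 ∣ j` survive the average. They form a two-sided
geometric series of ratio `σ = ρ^(2m+1) ≤ 1/2`, whose sum `(1+σ)/(1-σ)` is at most `3`. -/
lemma mean_poisson_le {m : ℕ} (hm : 1 ≤ m) (y : Torus) :
    (1 / (2 * m + 1) : ℝ) * ∑ s ∈ Finset.range (2 * m + 1), poisson (1 - 1 / m) (node m s - y) ≤
      3 := by
  have hm' : (1 : ℝ) ≤ m := by exact_mod_cast hm
  set ρ : ℝ := 1 - 1 / m with hρ
  have h1 : 1 / (m : ℝ) ≤ 1 := by rw [div_le_one (by linarith)]; exact hm'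
  have h2 : 0 < 1 / (m : ℝ) := by positivity
  have h0 : 0 ≤ ρ := by linarith
  have h1 : ρ < 1 := by linarith
  set σ : ℝ := ρ ^ (2 * m + 1) with hσ
  have hσ0 : 0 ≤ σ := by positivity
  have hσ1 : σ ≤ 1 / 2 := one_sub_inv_pow_le m hm
  have hN : (2 * (m : ℤ) + 1) ≠ 0 := by positivity
  have hinj : Function.Injective fun l : ℤ => (2 * (m : ℤ) + 1) * l := mul_right_injective₀ hN
  have hval : ∀ l : ℤ, |ρ ^ ((2 * (m : ℤ) + 1) * l).natAbs| = |σ ^ l.natAbs| := fun l => by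
    rw [hσ, ← pow_mul, Int.natAbs_mul]; congr
  have hsum := summable_pow_natAbs h0 h1
  have key : ‖∑' j : ℤ, (if (2 * m + 1 : ℤ) ∣ j then ((ρ ^ j.natAbs : ℝ) : ℂ) else 0) *
      fourier (-j) y‖ ≤ 3 := by
    have hnorm : ∀ j : ℤ, ‖(if (2 * m + 1 : ℤ) ∣ j then ((ρ ^ j.natAbs : ℝ) : ℂ) else 0) *
      (fourier (-j) y : ℂ)‖ = if (2 * m + 1 : ℤ) ∣ j then |ρ ^ j.natAbs| else 0 := fun j => by
      rw [norm_mul, norm_fourier_apply, mul_one]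
      split_ifs
      · rw [Complex.norm_real, Real.norm_eq_abs]
      · simp
    have hs : Summable fun j : ℤ => if (2 * m + 1 : ℤ) ∣ j then |ρ ^ j.natAbs| else 0 :=
      hsum.of_nonneg_of_le (fun j => by split_ifs <;> positivity)
        fun j => by split_ifs <;> simp
    refine (norm_tsum_le_tsum_norm (by simpa only [hnorm] using hs)).trans ?_
    simp_rw [hnorm]
    rw [← hinj.tsum_eq (f := fun j : ℤ => if (2 * m + 1 : ℤ) ∣ j then |ρ ^ j.natAbs| else 0)]
    -- The remaining sum `∑ σ^|l|` is itself the Poisson kernel of radius `σ` at the origin.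
    · simp only [dvd_mul_right, if_true, hval]
      have hp := trigSeries_pow_natAbs hσ0 (by linarith) 0
      have : trigSeries (fun j => σ ^ j.natAbs) 0 = ((∑' j : ℤ, |σ ^ j.natAbs| : ℝ) : ℂ) := by
        unfold trigSeries
        rw [Complex.ofReal_tsum]
        refine tsum_congr fun j => ?_
        rw [fourier_eval_zero, mul_one, abs_of_nonneg (by positivity)]
      rw [this] at hp
      rw [Complex.ofReal_inj.1 hp, poisson, fourier_eval_zero, mul_one]
      have e : ‖(1 : ℂ) - σ‖ = 1 - σ := by
        rw [← Complex.ofReal_one, ← Complex.ofReal_sub, Complex.norm_real, Real.norm_eq_abs,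
          abs_of_nonneg (by linarith)]
      rw [e, div_le_iff₀ (by nlinarith)]
      nlinarith
    · intro j hj
      simp only [Function.mem_support] at hj
      by_cases h : (2 * m + 1 : ℤ) ∣ j
      · obtain ⟨l, rfl⟩ := h; exact ⟨l, rfl⟩
      · simp [h] at hj
  rw [← mean_trigSeries hsum] at key
  simp_rw [trigSeries_pow_natAbs h0 h1] at key
  have hc : (1 / (2 * m + 1) : ℂ) * ∑ s ∈ Finset.range (2 * m + 1),
      (poisson ρ (node m s - y) : ℂ) = (((1 / (2 * m + 1) : ℝ) * ∑ s ∈ Finset.range (2 * m + 1),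
        poisson ρ (node m s - y) : ℝ) : ℂ) := by push_cast; rfl
  rw [hc, Complex.norm_real] at key
  exact (le_abs_self _).trans key

/-- Bounds on the absolute sums of a sequence and of its second differences, which make the `L¹`
norm and the discrete means of its trigonometric series at most `6 B`. -/
structure CoeffBound (a : ℤ → ℝ) (B : ℝ) (m : ℕ) : Prop where
  summable : Summable fun j => |a j|
  sum_le : ∑' j, |a j| ≤ B * m
  secondDiff_le : ∑' j, |secondDiff a j| ≤ B / m

lemma CoeffBound.nonneg {a : ℤ → ℝ} {B : ℝ} {m : ℕ} (h : CoeffBound a B m) (hm : 1 ≤ m) :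
    0 ≤ B := by
  have hm' : (1 : ℝ) ≤ m := by exact_mod_cast hm
  exact nonneg_of_mul_nonneg_left ((tsum_nonneg fun j => abs_nonneg (a j)).trans h.sum_le)
    (by linarith)

lemma CoeffBound.mean_le {a : ℤ → ℝ} {B : ℝ} {m : ℕ} (h : CoeffBound a B m) (hm : 1 ≤ m)
    (y : Torus) :
    (1 / (2 * m + 1) : ℝ) * ∑ s ∈ Finset.range (2 * m + 1), ‖trigSeries a (node m s - y)‖ ≤
      6 * B := by
  have hB := h.nonneg hm
  calc _ ≤ (1 / (2 * m + 1) : ℝ) * ∑ s ∈ Finset.range (2 * m + 1),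
        2 * B * poisson (1 - 1 / m) (node m s - y) := by
        gcongr
        exact norm_trigSeries_le_poisson h.summable hm h.sum_le h.secondDiff_le _
    _ = 2 * B * ((1 / (2 * m + 1) : ℝ) * ∑ s ∈ Finset.range (2 * m + 1),
        poisson (1 - 1 / m) (node m s - y)) := by rw [← Finset.mul_sum]; ring
    _ ≤ 2 * B * 3 := by gcongr; exact mean_poisson_le hm y
    _ = 6 * B := by ring

lemma CoeffBound.mean_le' {a : ℤ → ℝ} {B : ℝ} {m : ℕ} (h : CoeffBound a B m) (hm : 1 ≤ m)
    (x : Torus) :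
    (1 / (2 * m + 1) : ℝ) * ∑ s ∈ Finset.range (2 * m + 1), ‖trigSeries a (x - node m s)‖ ≤
      6 * B := by
  have hB := h.nonneg hm
  calc _ ≤ (1 / (2 * m + 1) : ℝ) * ∑ s ∈ Finset.range (2 * m + 1),
        2 * B * poisson (1 - 1 / m) (node m s - x) := by
        gcongr with s
        rw [← poisson_neg, neg_sub]
        exact norm_trigSeries_le_poisson h.summable hm h.sum_le h.secondDiff_le _
    _ = 2 * B * ((1 / (2 * m + 1) : ℝ) * ∑ s ∈ Finset.range (2 * m + 1),
        poisson (1 - 1 / m) (node m s - x)) := by rw [← Finset.mul_sum]; ring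
    _ ≤ 2 * B * 3 := by gcongr; exact mean_poisson_le hm x
    _ = 6 * B := by ring

/-- Continuous functions on the torus are integrable. -/
lemma integrable_of_continuous {E : Type*} [NormedAddCommGroup E] {f : Torus → E}
    (hf : Continuous f) : Integrable f circleMeasure :=
  hf.integrable_of_hasCompactSupport (HasCompactSupport.of_compactSpace f)

instance : circleMeasure.IsNegInvariant := by
  unfold circleMeasure AddCircle.haarAddCircle
  infer_instance

/-- By translation invariance, the `L¹` norm is the average over `y` of the discrete means of
`CoeffBound.mean_le`. -/
lemma CoeffBound.integral_le {a : ℤ → ℝ} {B : ℝ} {m : ℕ} (h : CoeffBound a B m) (hm : 1 ≤ m) :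
    ∫ x, ‖trigSeries a x‖ ∂circleMeasure ≤ 6 * B := by
  have hc : Continuous fun x => ‖trigSeries a x‖ := (continuous_trigSeries h.summable).norm
  have hcs : ∀ s, Integrable (fun y => ‖trigSeries a (node m s - y)‖) circleMeasure := fun s =>
    integrable_of_continuous (hc.comp (continuous_sub_left _))
  have h1 : ∫ y, (1 / (2 * m + 1) : ℝ) * ∑ s ∈ Finset.range (2 * m + 1),
      ‖trigSeries a (node m s - y)‖ ∂circleMeasure = ∫ x, ‖trigSeries a x‖ ∂circleMeasure := by
    rw [integral_const_mul, integral_finsetSum _ fun s _ => hcs s]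
    simp_rw [integral_sub_left_eq_self (fun x => ‖trigSeries a x‖) circleMeasure]
    simp
    field_simp
  rw [← h1]
  calc _ ≤ ∫ _ : Torus, 6 * B ∂circleMeasure :=
        integral_mono ((integrable_finsetSum _ fun s _ => hcs s).const_mul _)
          (integrable_const _) fun y => h.mean_le hm y
    _ = 6 * B := by simp

/-! ### Second differences and power sums -/

lemma ContDiff.hasDerivAt_deriv {f : ℝ → ℝ} (hf : ContDiff ℝ 2 f) (t : ℝ) :
    HasDerivAt f (deriv f t) t ∧ HasDerivAt (deriv f) (deriv (deriv f) t) t := by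
  have h1 : ContDiff ℝ 1 (deriv f) := by
    have : ContDiff ℝ (1 + 1) f := by simpa [one_add_one_eq_two] using hf
    exact (contDiff_succ_iff_deriv.1 this).2.2
  exact ⟨(hf.differentiable (by norm_num) t).hasDerivAt,
    (h1.differentiable (by norm_num) t).hasDerivAt⟩

lemma ContDiff.continuous_deriv_deriv {f : ℝ → ℝ} (hf : ContDiff ℝ 2 f) :
    Continuous (deriv (deriv f)) := by
  have h1 : ContDiff ℝ 1 (deriv f) := by
    have : ContDiff ℝ (1 + 1) f := by simpa [one_add_one_eq_two] using hf
    exact (contDiff_succ_iff_deriv.1 this).2.2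
  exact h1.continuous_deriv le_rfl

/-- The mean value inequality, once for `f'` on unit intervals and once for `f(t+1) - f(t)` on
`[x-1, x]`. -/
lemma abs_second_difference_le {f : ℝ → ℝ} (hf : ContDiff ℝ 2 f) {x K : ℝ}
    (hK : ∀ t ∈ Set.Icc (x - 1) (x + 1), |deriv (deriv f) t| ≤ K) :
    |f (x + 1) - 2 * f x + f (x - 1)| ≤ K := by
  have hd := fun t => (ContDiff.hasDerivAt_deriv hf t).1
  have hd2 := fun t => (ContDiff.hasDerivAt_deriv hf t).2
  have h1 : ∀ t ∈ Set.Icc (x - 1) x, |deriv f (t + 1) - deriv f t| ≤ K := fun t ht => by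
    have := Convex.norm_image_sub_le_of_norm_hasDerivWithin_le (f := deriv f)
      (s := Set.Icc (x - 1) (x + 1)) (C := K) (x := t) (y := t + 1)
      (fun s _ => (hd2 s).hasDerivWithinAt) (fun s hs => hK s hs) (convex_Icc _ _)
      ⟨ht.1, by linarith [ht.2]⟩ ⟨by linarith [ht.1], by linarith [ht.2]⟩
    simpa using this
  have := Convex.norm_image_sub_le_of_norm_hasDerivWithin_le (f := fun t => f (t + 1) - f t)
    (s := Set.Icc (x - 1) x) (C := K) (x := x - 1) (y := x)
    (fun s _ => (((hd (s + 1)).comp_add_const s 1).sub (hd s)).hasDerivWithinAt)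
    (fun s hs => h1 s hs) (convex_Icc _ _) ⟨le_rfl, by linarith⟩ ⟨by linarith, le_rfl⟩
  simp only [sub_add_cancel, sub_sub_cancel, norm_one, mul_one, Real.norm_eq_abs] at this
  convert this using 2; ring

lemma sum_rpow_neg_le {s : ℝ} (hs : 1 < s) {m : ℕ} (hm : 1 ≤ m) (n : ℕ) :
    ∑ i ∈ Finset.range n, ((m : ℝ) + i + 1) ^ (-s) ≤ (m : ℝ) ^ (1 - s) / (s - 1) := by
  have hm' : (1 : ℝ) ≤ m := by exact_mod_cast hm
  have h : AntitoneOn (fun x : ℝ => x ^ (-s)) (Set.Icc (m : ℝ) (m + n)) := fun x hx y _ hxy =>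
    Real.rpow_le_rpow_of_nonpos (by linarith [hx.1]) hxy (by linarith)
  have h1 := h.sum_le_integral
  rw [integral_rpow (Or.inr ⟨by linarith, by
    rw [Set.uIcc_of_le (by linarith [(Nat.cast_nonneg n : (0 : ℝ) ≤ n)])]
    intro h0; linarith [h0.1]⟩)] at h1
  have h2 : ∑ i ∈ Finset.range n, ((m : ℝ) + i + 1) ^ (-s) =
      ∑ i ∈ Finset.range n, ((m : ℝ) + ((i + 1 : ℕ) : ℝ)) ^ (-s) :=
    Finset.sum_congr rfl fun i _ => by push_cast; ring_nf
  rw [h2]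
  refine h1.trans ?_
  have h3 : (((m : ℝ) + n) ^ (-s + 1) - (m : ℝ) ^ (-s + 1)) / (-s + 1) =
      ((m : ℝ) ^ (1 - s) - ((m : ℝ) + n) ^ (1 - s)) / (s - 1) := by
    rw [show -s + 1 = 1 - s by ring, ← neg_sub ((m : ℝ) ^ (1 - s)), ← neg_sub s 1, neg_div_neg_eq]
  rw [h3]
  refine div_le_div_of_nonneg_right ?_ (by linarith)
  have : 0 ≤ ((m : ℝ) + n) ^ (1 - s) := by positivity
  linarith

/-- If `m/2 ≤ 1 + |j|` then `m + |j| + 1 ≤ 3 (1 + |j|)`, which costs `3^s` and replaces the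
truncated sum by a shifted sum over all `j`, to which the integral comparison applies on each
half-line. The cut at `1 + |j|` rather than `|j|` leaves room for second differences, which reach
the neighbours of `j`. -/
lemma tail_rpow_le {s : ℝ} (hs : 1 < s) {m : ℕ} (hm : 1 ≤ m) :
    (Summable fun j : ℤ => if (m : ℝ) / 2 ≤ 1 + |(j : ℝ)| then (1 + |(j : ℝ)|) ^ (-s) else 0) ∧
    ∑' j : ℤ, (if (m : ℝ) / 2 ≤ 1 + |(j : ℝ)| then (1 + |(j : ℝ)|) ^ (-s) else 0) ≤
      3 ^ s * (2 / (s - 1)) * (m : ℝ) ^ (1 - s) := by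
  have hm' : (1 : ℝ) ≤ m := by exact_mod_cast hm
  have hnn : ∀ n : ℕ, 0 ≤ ((m : ℝ) + n + 1) ^ (-s) := fun n => by positivity
  have hsum : Summable fun n : ℕ => ((m : ℝ) + n + 1) ^ (-s) :=
    summable_of_sum_range_le hnn (sum_rpow_neg_le hs hm)
  have hle := hsum.tsum_le_of_sum_range_le (sum_rpow_neg_le hs hm)
  have hsum2 : Summable fun n : ℕ => ((m : ℝ) + n + 2) ^ (-s) :=
    hsum.of_nonneg_of_le (fun n => by positivity) fun n =>
      Real.rpow_le_rpow_of_nonpos (by positivity) (by linarith) (by linarith)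
  have hle2 : ∑' n : ℕ, ((m : ℝ) + n + 2) ^ (-s) ≤ (m : ℝ) ^ (1 - s) / (s - 1) :=
    (hsum2.tsum_le_tsum (fun n => Real.rpow_le_rpow_of_nonpos (by positivity) (by linarith)
      (by linarith)) hsum).trans hle
  have hZ : HasSum (fun j : ℤ => ((m : ℝ) + |(j : ℝ)| + 1) ^ (-s))
      (∑' n : ℕ, ((m : ℝ) + n + 1) ^ (-s) + ∑' n : ℕ, ((m : ℝ) + n + 2) ^ (-s)) := by
    refine HasSum.of_nat_of_neg_add_one ?_ ?_
    · simpa using hsum.hasSum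
    · have e : (fun n : ℕ => ((m : ℝ) + |((-((n : ℤ) + 1) : ℤ) : ℝ)| + 1) ^ (-s)) =
          fun n : ℕ => ((m : ℝ) + n + 2) ^ (-s) := by
        funext n
        push_cast
        rw [abs_neg, abs_of_nonneg (by positivity)]
        congr 1; ring
      rw [e]; exact hsum2.hasSum
  have hb : ∀ j : ℤ, (if (m : ℝ) / 2 ≤ 1 + |(j : ℝ)| then (1 + |(j : ℝ)|) ^ (-s) else 0) ≤
      3 ^ s * ((m : ℝ) + |(j : ℝ)| + 1) ^ (-s) := fun j => by
    have hj := abs_nonneg (j : ℝ)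
    split_ifs with h
    · rw [Real.rpow_neg (by positivity), Real.rpow_neg (by positivity), ← div_eq_mul_inv,
        ← Real.div_rpow (by positivity) (by positivity), ← Real.inv_rpow (by positivity)]
      refine Real.rpow_le_rpow (by positivity) ?_ (by linarith)
      rw [inv_eq_one_div, div_le_div_iff₀ (by positivity) (by positivity)]
      linarith
    · positivity
  have hs2 : Summable fun j : ℤ => 3 ^ s * ((m : ℝ) + |(j : ℝ)| + 1) ^ (-s) :=
    hZ.summable.mul_left _
  have hs1 : Summable fun j : ℤ =>
      if (m : ℝ) / 2 ≤ 1 + |(j : ℝ)| then (1 + |(j : ℝ)|) ^ (-s) else 0 :=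
    hs2.of_nonneg_of_le (fun j => by split_ifs <;> positivity) hb
  refine ⟨hs1, (hs1.tsum_le_tsum hb hs2).trans ?_⟩
  rw [tsum_mul_left, hZ.tsum_eq, mul_assoc]
  gcongr
  calc _ ≤ (m : ℝ) ^ (1 - s) / (s - 1) + (m : ℝ) ^ (1 - s) / (s - 1) := add_le_add hle hle2
    _ = 2 / (s - 1) * (m : ℝ) ^ (1 - s) := by ring

/-! ### Cut-off functions -/

/-- Needed because `θ` enters the low-frequency part of the kernel of `opQ` twice, once through
`H_m` and once through the splitting of `phi`. -/
lemma IsCutoff.sq {θ : ℝ → ℝ} (h : IsCutoff θ) : IsCutoff fun t => θ t ^ 2 where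
  contDiff := h.contDiff.pow 2
  eq_one x hx := by simp [h.eq_one x hx]
  eq_zero x hx := by simp [h.eq_zero x hx]

lemma IsCutoff.eq_zero_of_le {θ : ℝ → ℝ} (h : IsCutoff θ) {x : ℝ} (hx : 1 ≤ |x|) : θ x = 0 :=
  h.eq_zero x fun hx' => by
    rcases le_abs'.1 hx with h1 | h1
    · linarith [hx'.1]
    · linarith [hx'.2]

lemma IsCutoff.eq_one_of_le {θ : ℝ → ℝ} (h : IsCutoff θ) {x : ℝ} (hx : |x| ≤ 1 / 2) : θ x = 1 :=
  h.eq_one x (abs_le.1 hx)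

lemma IsCutoff.deriv_eq_zero {θ : ℝ → ℝ} (h : IsCutoff θ) {x : ℝ} (hx : 1 < |x|) :
    deriv θ x = 0 ∧ deriv (deriv θ) x = 0 := by
  have hev : ∀ y : ℝ, 1 < |y| → deriv θ y = 0 := fun y hy => by
    have : θ =ᶠ[𝓝 y] fun _ => 0 := by
      filter_upwards [(isOpen_lt continuous_const continuous_abs).mem_nhds hy] with z hz
      exact h.eq_zero_of_le (le_of_lt hz)
    rw [this.deriv_eq]; simp
  refine ⟨hev x hx, ?_⟩
  have : deriv θ =ᶠ[𝓝 x] fun _ => 0 := by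
    filter_upwards [(isOpen_lt continuous_const continuous_abs).mem_nhds hx] with z hz
    exact hev z hz
  rw [this.deriv_eq]; simp

lemma exists_bound_of_eq_zero {f : ℝ → ℝ} (hf : Continuous f) (h0 : ∀ x, 1 < |x| → f x = 0) :
    ∃ M, ∀ x, |f x| ≤ M := by
  obtain ⟨M, hM⟩ := (isCompact_Icc (a := (-1 : ℝ)) (b := 1)).exists_bound_of_continuousOn
    hf.continuousOn
  refine ⟨max M 0, fun x => ?_⟩
  by_cases hx : 1 < |x|
  · rw [h0 x hx, abs_zero]; exact le_max_right _ _
  · exact (hM x (abs_le.1 (not_lt.1 hx))).trans (le_max_left _ _)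

lemma IsCutoff.exists_bound {θ : ℝ → ℝ} (h : IsCutoff θ) :
    ∃ M, 1 ≤ M ∧ ∀ x, |θ x| ≤ M ∧ |deriv θ x| ≤ M ∧ |deriv (deriv θ) x| ≤ M := by
  obtain ⟨M0, h0⟩ := exists_bound_of_eq_zero h.contDiff.continuous
    fun x hx => h.eq_zero_of_le hx.le
  obtain ⟨M1, h1⟩ := exists_bound_of_eq_zero (h.contDiff.continuous_deriv (by norm_num))
    fun x hx => (h.deriv_eq_zero hx).1
  obtain ⟨M2, h2⟩ := exists_bound_of_eq_zero (ContDiff.continuous_deriv_deriv h.contDiff)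
    fun x hx => (h.deriv_eq_zero hx).2
  refine ⟨max 1 (max M0 (max M1 M2)), le_max_left _ _, fun x => ⟨(h0 x).trans ?_, (h1 x).trans ?_,
    (h2 x).trans ?_⟩⟩ <;> simp

lemma deriv_comp_div {f : ℝ → ℝ} (hf : ContDiff ℝ 2 f) (m : ℝ) (t : ℝ) :
    HasDerivAt (fun t => f (t / m)) (deriv f (t / m) / m) t ∧
    HasDerivAt (fun t => deriv f (t / m)) (deriv (deriv f) (t / m) / m) t := by
  have hd : HasDerivAt (fun t : ℝ => t / m) (1 / m) t := (hasDerivAt_id t).div_const m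
  have h := ContDiff.hasDerivAt_deriv hf (t / m)
  refine ⟨?_, ?_⟩
  · have := h.1.comp t hd
    rwa [mul_one_div] at this
  · have := h.2.comp t hd
    rwa [mul_one_div] at this

lemma tsum_le_of_support {b : ℤ → ℝ} {M : ℝ} {m : ℕ} (hm : 1 ≤ m) (hM : 0 ≤ M)
    (hb : ∀ j, |b j| ≤ M) (h0 : ∀ j : ℤ, (m : ℤ) < |j| → b j = 0) :
    (Summable fun j => |b j|) ∧ ∑' j, |b j| ≤ 3 * M * m := by
  have hz : ∀ j ∉ Finset.Icc (-(m : ℤ)) m, |b j| = 0 := fun j hj => by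
    rw [h0 j, abs_zero]
    by_contra hlt
    exact hj (Finset.mem_Icc.2 (abs_le.1 (not_lt.1 hlt)))
  refine ⟨summable_of_ne_finset_zero (s := Finset.Icc (-(m : ℤ)) m) hz, ?_⟩
  rw [tsum_eq_sum hz]
  refine (Finset.sum_le_card_nsmul _ _ M fun j _ => hb j).trans ?_
  rw [Int.card_Icc, nsmul_eq_mul]
  have : (((m : ℤ) + 1 - -(m : ℤ)).toNat : ℝ) = 2 * m + 1 := by
    rw [show (m : ℤ) + 1 - -(m : ℤ) = ((2 * m + 1 : ℕ) : ℤ) by push_cast; ring, Int.toNat_natCast]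
    push_cast; ring
  rw [this]
  have hm' : (1 : ℝ) ≤ m := by exact_mod_cast hm
  nlinarith

/-- Scaling: the values are bounded, the second differences are `O(m⁻²)` as `θ(t/m)'' = m⁻²
θ''(t/m)`, and at most `2m+1 ≤ 3m` of either are nonzero. -/
lemma IsCutoff.coeffBound {θ : ℝ → ℝ} (h : IsCutoff θ) :
    ∃ B, ∀ m : ℕ, 1 ≤ m → CoeffBound (fun j : ℤ => θ ((j : ℝ) / m)) B m := by
  obtain ⟨M, hM1, hM⟩ := h.exists_bound
  refine ⟨3 * M, fun m hm => ?_⟩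
  have hm' : (1 : ℝ) ≤ m := by exact_mod_cast hm
  have hM0 : 0 ≤ M := by linarith
  have hvan : ∀ j : ℤ, (m : ℤ) ≤ |j| → θ ((j : ℝ) / m) = 0 := fun j hj => by
    refine h.eq_zero_of_le ?_
    rw [abs_div, Nat.abs_cast, le_div_iff₀ (by linarith), one_mul]
    exact_mod_cast hj
  have h1 := tsum_le_of_support hm hM0 (fun j : ℤ => (hM ((j : ℝ) / m)).1) fun j hj => hvan j hj.le
  have hc : ContDiff ℝ 2 fun t : ℝ => θ (t / m) := h.contDiff.comp (contDiff_id.div_const _)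
  have hdd : ∀ t, deriv (deriv fun t : ℝ => θ (t / m)) t = deriv (deriv θ) (t / m) / m / m := by
    intro t
    have e : (deriv fun t : ℝ => θ (t / m)) = fun t => deriv θ (t / m) / m :=
      funext fun t => (deriv_comp_div h.contDiff m t).1.deriv
    rw [e]
    exact ((deriv_comp_div h.contDiff m t).2.div_const _).deriv
  have h2 := tsum_le_of_support (b := secondDiff fun j : ℤ => θ ((j : ℝ) / m))
    (M := M / m / m) hm (by positivity) (fun j => by
      unfold secondDiff
      push_cast
      refine abs_second_difference_le hc fun t _ => ?_
      rw [hdd, abs_div, abs_div, Nat.abs_cast]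
      gcongr
      exact (hM _).2.2) (fun j hj => by
      -- The sequence already vanishes at `|j| = m`, so its second differences have support in `|j|
      -- ≤ m`.
      have e1 : (m : ℤ) ≤ |j + 1| := by have := abs_sub_abs_le_abs_sub (j + 1) 1; grind
      have e2 : (m : ℤ) ≤ |j - 1| := by grind
      simp only [secondDiff, hvan _ hj.le, hvan _ e1, hvan _ e2]; ring)
  refine ⟨h1.1, h1.2, h2.2.trans_eq ?_⟩
  field_simp

/-! ### Estimates for masks -/

/-- The model mask `t^{-r} (log (t + 1))^{-κ}`. -/
def modelMask (r κ t : ℝ) : ℝ := t ^ (-r) * Real.log (t + 1) ^ (-κ)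

/-- The logarithmic derivative of `modelMask`. -/
def modelLogDeriv (r κ t : ℝ) : ℝ := -r / t - κ / ((t + 1) * Real.log (t + 1))

lemma log_add_one_pos {t : ℝ} (ht : 0 < t) : 0 < Real.log (t + 1) := Real.log_pos (by linarith)

lemma hasDerivAt_log_add_one {t : ℝ} (ht : 0 < t) :
    HasDerivAt (fun t : ℝ => Real.log (t + 1)) (1 / (t + 1)) t :=
  ((hasDerivAt_id t).add_const 1).log (by simp; linarith)

lemma hasDerivAt_modelMask (r κ : ℝ) {t : ℝ} (ht : 0 < t) :
    HasDerivAt (modelMask r κ) (modelMask r κ t * modelLogDeriv r κ t) t := by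
  have hl := log_add_one_pos ht
  have h1 : HasDerivAt (fun t : ℝ => t ^ (-r)) (-r * t ^ (-r - 1)) t :=
    Real.hasDerivAt_rpow_const (Or.inl ht.ne')
  have h2 := (hasDerivAt_log_add_one ht).rpow_const (p := -κ) (Or.inl hl.ne')
  refine (h1.mul h2).congr_deriv ?_
  rw [Real.rpow_sub_one ht.ne', Real.rpow_sub_one hl.ne']
  unfold modelMask modelLogDeriv
  field_simp
  ring

lemma hasDerivAt_modelLogDeriv (r κ : ℝ) {t : ℝ} (ht : 0 < t) :
    HasDerivAt (modelLogDeriv r κ)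
      (r / t ^ 2 + κ * (Real.log (t + 1) + 1) / ((t + 1) * Real.log (t + 1)) ^ 2) t := by
  have hl := log_add_one_pos ht
  have h1 : HasDerivAt (fun t : ℝ => -r / t) (r / t ^ 2) t := by
    refine ((hasDerivAt_const t (-r)).div (hasDerivAt_id t) ht.ne').congr_deriv ?_
    simp
  have h2 : HasDerivAt (fun t : ℝ => (t + 1) * Real.log (t + 1)) (Real.log (t + 1) + 1) t := by
    refine (((hasDerivAt_id t).add_const 1).mul (hasDerivAt_log_add_one ht)).congr_deriv ?_
    simp only [id]
    field_simp
  have hne : (t + 1) * Real.log (t + 1) ≠ 0 := by positivity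
  refine (h1.sub ((hasDerivAt_const t κ).div h2 hne)).congr_deriv ?_
  field_simp
  ring

lemma one_le_log_add_one {t : ℝ} (ht : 3 ≤ t) : 1 ≤ Real.log (t + 1) := by
  rw [Real.le_log_iff_exp_le (by linarith)]
  linarith [Real.exp_one_lt_d9]

lemma abs_modelLogDeriv_le {r κ t : ℝ} (hr : 0 ≤ r) (hκ : 0 ≤ κ) (ht : 3 ≤ t) :
    |modelLogDeriv r κ t| ≤ (r + κ) / t := by
  have hl := one_le_log_add_one ht
  have h0 : 0 < t := by linarith
  have e : modelLogDeriv r κ t = -(r / t + κ / ((t + 1) * Real.log (t + 1))) := by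
    unfold modelLogDeriv; ring
  rw [e, abs_neg, abs_of_nonneg (by positivity), add_div]
  gcongr
  nlinarith

lemma abs_deriv_modelLogDeriv_le {r κ t : ℝ} (hr : 0 ≤ r) (hκ : 0 ≤ κ) (ht : 3 ≤ t) :
    |r / t ^ 2 + κ * (Real.log (t + 1) + 1) / ((t + 1) * Real.log (t + 1)) ^ 2| ≤
      (r + 2 * κ) / t ^ 2 := by
  have hl := one_le_log_add_one ht
  have h0 : 0 < t := by linarith
  rw [abs_of_nonneg (by positivity), add_div]
  refine add_le_add le_rfl ?_
  rw [div_le_div_iff₀ (by positivity) (by positivity), mul_pow]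
  set l := Real.log (t + 1)
  have h1 : l + 1 ≤ 2 * l ^ 2 := by nlinarith
  have h2 : t ^ 2 ≤ (t + 1) ^ 2 := by gcongr; linarith
  calc κ * (l + 1) * t ^ 2 ≤ κ * (2 * l ^ 2) * (t + 1) ^ 2 := by gcongr
    _ = _ := by ring

lemma hasDerivAt_of_contDiffOn_Ioi {f : ℝ → ℝ} (hf : ContDiffOn ℝ 2 f (Set.Ioi 0)) {t : ℝ}
    (ht : 0 < t) :
    HasDerivAt f (deriv f t) t ∧ HasDerivAt (deriv f) (deriv (deriv f) t) t := by
  have h1 : ContDiffOn ℝ 1 (deriv f) (Set.Ioi 0) := by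
    have : ContDiffOn ℝ (1 + 1) f (Set.Ioi 0) := by simpa [one_add_one_eq_two] using hf
    exact ((contDiffOn_succ_iff_deriv_of_isOpen isOpen_Ioi).1 this).2.2
  have hn := isOpen_Ioi.mem_nhds (Set.mem_Ioi.2 ht)
  exact ⟨((hf.differentiableOn (by norm_num)).differentiableAt hn).hasDerivAt,
    ((h1.differentiableOn (by norm_num)).differentiableAt hn).hasDerivAt⟩

/-- A mask is `modelMask` times a function `f` with `f`, `t f'` and `t² f''` bounded. -/
lemma IsMask.exists_factor {r κ : ℝ} {lam : ℝ → ℝ} (h : IsMask r κ lam) :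
    ∃ (f f1 f2 : ℝ → ℝ) (a : ℝ), 0 ≤ a ∧ (∀ t, 0 < t → lam t = modelMask r κ t * f t) ∧
      (∀ t, 0 < t → HasDerivAt f (f1 t) t ∧ HasDerivAt f1 (f2 t) t) ∧
      ∀ t, 3 ≤ t → |f t| ≤ a ∧ |f1 t| ≤ a / t ∧ |f2 t| ≤ 2 * a / t ^ 2 := by
  obtain ⟨F, a, hF, ha⟩ := h.exists_profile
  have ha0 : 0 ≤ a := (abs_nonneg _).trans (ha 0 (by norm_num) 1 le_rfl)
  -- This is `F ∘ log` on `[1, ∞)`. Defining it from `lam` makes it twice continuously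
  -- differentiable on `(0, ∞)` with no appeal to the regularity of `F`.
  set f : ℝ → ℝ := fun t => lam t * (t ^ r * Real.log (t + 1) ^ κ) with hf
  have hlf : ∀ t, 0 < t → lam t = modelMask r κ t * f t := fun t ht => by
    have hl := log_add_one_pos ht
    have h1 : (0 : ℝ) < t ^ r := by positivity
    have h2 : 0 < Real.log (t + 1) ^ κ := by positivity
    rw [hf, modelMask, Real.rpow_neg ht.le, Real.rpow_neg hl.le]
    field_simp
  have hfc : ContDiffOn ℝ 2 f (Set.Ioi 0) := by
    refine h.contDiff.contDiffOn.mul (ContDiffOn.mul ?_ ?_)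
    · exact contDiffOn_id.rpow_const_of_ne fun t ht => (Set.mem_Ioi.1 ht).ne'
    · refine ContDiffOn.rpow_const_of_ne ?_ fun t ht => (log_add_one_pos ht).ne'
      exact (contDiffOn_id.add contDiffOn_const).log fun t ht => by
        have := Set.mem_Ioi.1 ht
        simp only [id]; linarith
  have hd := fun t (ht : 0 < t) => hasDerivAt_of_contDiffOn_Ioi hfc ht
  have hFf : ∀ s, 0 ≤ s → F s = f (Real.exp s) := fun s hs => by
    have he : 0 < Real.exp s := Real.exp_pos s
    have hl := log_add_one_pos he
    have h1 : (0 : ℝ) < Real.exp s ^ r := by positivity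
    have h2 : 0 < Real.log (Real.exp s + 1) ^ κ := by positivity
    rw [hf]
    simp only
    rw [hF _ (Real.one_le_exp hs), Real.log_exp, Real.rpow_neg he.le, Real.rpow_neg hl.le]
    field_simp
  have hF1 : ∀ s, 0 < s → HasDerivAt F (deriv f (Real.exp s) * Real.exp s) s := fun s hs => by
    refine ((hd _ (Real.exp_pos s)).1.comp s (Real.hasDerivAt_exp s)).congr_of_eventuallyEq ?_
    filter_upwards [isOpen_Ioi.mem_nhds (Set.mem_Ioi.2 hs)] with u hu
    exact hFf u (le_of_lt hu)
  have hF2 : ∀ s, 0 < s → HasDerivAt (deriv F) (deriv (deriv f) (Real.exp s) * Real.exp s ^ 2 +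
      deriv f (Real.exp s) * Real.exp s) s := fun s hs => by
    have h1 := ((hd _ (Real.exp_pos s)).2.comp s (Real.hasDerivAt_exp s)).mul
      (Real.hasDerivAt_exp s)
    refine (h1.congr_deriv (by simp only [Function.comp]; ring)).congr_of_eventuallyEq ?_
    filter_upwards [isOpen_Ioi.mem_nhds (Set.mem_Ioi.2 hs)] with u hu
    exact (hF1 u hu).deriv
  refine ⟨f, deriv f, deriv (deriv f), a, ha0, hlf, hd, fun t ht => ?_⟩
  have ht0 : 0 < t := by linarith
  -- The threshold `3` exceeds `e`, so `log t` lies in the range where the derivatives of `F` are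
  -- bounded.
  have hs : 1 ≤ Real.log t := by
    rw [Real.le_log_iff_exp_le ht0]; linarith [Real.exp_one_lt_d9]
  have hs0 : 0 < Real.log t := by linarith
  have b0 := ha 0 (by norm_num) _ hs
  have b1 := ha 1 (by norm_num) _ hs
  have b2 := ha 2 le_rfl _ hs
  rw [iteratedDeriv_zero, hFf _ hs0.le, Real.exp_log ht0] at b0
  rw [iteratedDeriv_one, (hF1 _ hs0).deriv, Real.exp_log ht0] at b1
  rw [iteratedDeriv_succ, iteratedDeriv_one, (hF2 _ hs0).deriv, Real.exp_log ht0] at b2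
  refine ⟨b0, ?_, ?_⟩
  · rw [le_div_iff₀ ht0]
    rwa [abs_mul, abs_of_pos ht0] at b1
  -- At `s = log t` one has `t² f'' = F'' - F'`, whence the factor `2`.
  · rw [le_div_iff₀ (by positivity), ← abs_of_pos (by positivity : 0 < t ^ 2), ← abs_mul]
    calc _ = |(deriv (deriv f) t * t ^ 2 + deriv f t * t) - deriv f t * t| := by ring_nf
      _ ≤ _ := abs_sub _ _
      _ ≤ 2 * a := by linarith

/-- Write `lam = P f` with `P' = P u`, where `u` is the logarithmic derivative of the model mask.
Each differentiation keeps the factor `P` and gains `1/t`, since `u = O(1/t)`, `u' = O(1/t²)` and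
`f`, `t f'`, `t² f''` are bounded. -/
lemma IsMask.bound_large {r κ : ℝ} {lam : ℝ → ℝ} (h : IsMask r κ lam) (hr : 0 ≤ r) (hκ : 0 ≤ κ) :
    ∃ C, 0 ≤ C ∧ ∀ t, 3 ≤ t → |lam t| ≤ C * modelMask r κ t ∧
      |deriv lam t| ≤ C * modelMask r κ t / t ∧
      |deriv (deriv lam) t| ≤ C * modelMask r κ t / t ^ 2 := by
  obtain ⟨f, f1, f2, a, ha, hlam, hd, hb⟩ := h.exists_factor
  have h1 : ∀ t, 0 < t → HasDerivAt lam
      (modelMask r κ t * (modelLogDeriv r κ t * f t + f1 t)) t := fun t ht => by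
    refine (((hasDerivAt_modelMask r κ ht).mul (hd t ht).1).congr_deriv (by ring)).congr_of_eventuallyEq ?_
    filter_upwards [isOpen_Ioi.mem_nhds (Set.mem_Ioi.2 ht)] with u hu
    exact hlam u hu
  have h2 : ∀ t, 0 < t → HasDerivAt (deriv lam) (modelMask r κ t *
      (modelLogDeriv r κ t * (modelLogDeriv r κ t * f t + f1 t) +
        ((r / t ^ 2 + κ * (Real.log (t + 1) + 1) / ((t + 1) * Real.log (t + 1)) ^ 2) * f t +
          modelLogDeriv r κ t * f1 t + f2 t))) t := fun t ht => by
    refine (((hasDerivAt_modelMask r κ ht).mul (((hasDerivAt_modelLogDeriv r κ ht).mul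
      (hd t ht).1).add (hd t ht).2)).congr_deriv
        (by simp only [Pi.add_apply, Pi.mul_apply]; ring)).congr_of_eventuallyEq ?_
    filter_upwards [isOpen_Ioi.mem_nhds (Set.mem_Ioi.2 ht)] with u hu
    exact (h1 u hu).deriv
  -- `c` dominates the constants for `u` and `u'`; the summand `1` gives `c ≥ 1`, so that `2c²a +
  -- 2ca + 2a ≤ 6c²a`.
  set c := r + 2 * κ + 1 with hc
  have hc1 : 1 ≤ c := by linarith
  have hcc : c ≤ c ^ 2 := by nlinarith
  refine ⟨6 * c ^ 2 * a, by positivity, fun t ht => ?_⟩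
  have ht0 : 0 < t := by linarith
  obtain ⟨b0, b1, b2⟩ := hb t ht
  have hP : 0 ≤ modelMask r κ t := by
    have := log_add_one_pos ht0
    unfold modelMask; positivity
  have hu : |modelLogDeriv r κ t| ≤ c / t := (abs_modelLogDeriv_le hr hκ ht).trans (by gcongr; linarith)
  have hu1 := (abs_deriv_modelLogDeriv_le hr hκ ht).trans (b := (r + 2 * κ) / t ^ 2)
    (c := c / t ^ 2) (by gcongr; linarith)
  set u := modelLogDeriv r κ t
  set v := r / t ^ 2 + κ * (Real.log (t + 1) + 1) / ((t + 1) * Real.log (t + 1)) ^ 2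
  have hca : a ≤ c ^ 2 * a := le_mul_of_one_le_left ha (by linarith)
  have hca2 : c * a ≤ c ^ 2 * a := by gcongr
  have k1 : |u * f t + f1 t| ≤ 2 * c * a / t := by
    calc _ ≤ |u| * |f t| + |f1 t| := by rw [← abs_mul]; exact abs_add_le _ _
      _ ≤ c / t * a + a / t := by gcongr
      _ = (c * a + a) / t := by ring
      _ ≤ 2 * c * a / t := by gcongr; nlinarith
  have k2 : |u * (u * f t + f1 t) + (v * f t + u * f1 t + f2 t)| ≤ 6 * c ^ 2 * a / t ^ 2 := by
    calc _ ≤ |u| * |u * f t + f1 t| + (|v| * |f t| + |u| * |f1 t| + |f2 t|) := by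
          rw [← abs_mul, ← abs_mul, ← abs_mul]
          refine (abs_add_le _ _).trans ?_
          gcongr
          refine (abs_add_le _ _).trans ?_
          gcongr
          exact abs_add_le _ _
      _ ≤ c / t * (2 * c * a / t) + (c / t ^ 2 * a + c / t * (a / t) + 2 * a / t ^ 2) := by gcongr
      _ = (2 * (c ^ 2 * a) + 2 * (c * a) + 2 * a) / t ^ 2 := by field_simp; ring
      _ ≤ 6 * c ^ 2 * a / t ^ 2 := by gcongr; linarith
  refine ⟨?_, ?_, ?_⟩
  · rw [hlam t ht0, abs_mul, abs_of_nonneg hP, mul_comm]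
    refine mul_le_mul_of_nonneg_right ?_ hP
    nlinarith
  · rw [(h1 t ht0).deriv, abs_mul, abs_of_nonneg hP]
    calc _ ≤ modelMask r κ t * (2 * c * a / t) := by gcongr
      _ ≤ modelMask r κ t * (6 * c ^ 2 * a / t) := by gcongr ?_ * (?_ / _); nlinarith
      _ = _ := by ring
  · rw [(h2 t ht0).deriv, abs_mul, abs_of_nonneg hP]
    calc _ ≤ modelMask r κ t * (6 * c ^ 2 * a / t ^ 2) := by gcongr
      _ = _ := by ring

/-- The weight `(1 + |t|)^s (log (|t| + 2))^κ`. -/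
def weight (s κ t : ℝ) : ℝ := (1 + |t|) ^ s * Real.log (|t| + 2) ^ κ

lemma log_abs_add_two_pos (t : ℝ) : 0 < Real.log (|t| + 2) :=
  Real.log_pos (by linarith [abs_nonneg t])

lemma weight_pos (s κ t : ℝ) : 0 < weight s κ t := by
  have := log_abs_add_two_pos t
  unfold weight; positivity

lemma continuous_weight (s κ : ℝ) : Continuous (weight s κ) := by
  refine Continuous.mul ?_ ?_
  · refine (continuous_const.add continuous_abs).rpow_const fun t => Or.inl ?_
    exact (by linarith [abs_nonneg t] : (0 : ℝ) < 1 + |t|).ne'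
  · refine ((continuous_abs.add continuous_const).log fun t => ?_).rpow_const
      fun t => Or.inl (log_abs_add_two_pos t).ne'
    exact (by linarith [abs_nonneg t] : (0 : ℝ) < |t| + 2).ne'

lemma weight_neg (s κ t : ℝ) : weight s κ (-t) = weight s κ t := by unfold weight; rw [abs_neg]

/-- The two factors come from `1 + t ≤ 2t` and `t + 2 ≤ (t + 1)²`. -/
lemma modelMask_mul_weight_le {r κ : ℝ} (hr : 0 ≤ r) (hκ : 0 ≤ κ) (i : ℕ) {t : ℝ} (ht : 3 ≤ t) :
    modelMask r κ t / t ^ i * weight (r + i) κ t ≤ 2 ^ (r + i) * 2 ^ κ := by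
  have ht0 : 0 < t := by linarith
  have hl := log_add_one_pos ht0
  have hl2 := log_abs_add_two_pos t
  have h1 : (1 + |t|) ^ (r + i) ≤ (2 * t) ^ (r + i) := by
    rw [abs_of_pos ht0]
    exact Real.rpow_le_rpow (by positivity) (by linarith) (by positivity)
  have h2 : Real.log (|t| + 2) ^ κ ≤ (2 * Real.log (t + 1)) ^ κ := by
    refine Real.rpow_le_rpow hl2.le ?_ hκ
    rw [abs_of_pos ht0, ← Nat.cast_two, ← Real.log_pow]
    exact Real.log_le_log (by positivity) (by push_cast; nlinarith)
  have e1 : (0 : ℝ) < t ^ r := by positivity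
  have e2 : 0 < Real.log (t + 1) ^ κ := by positivity
  have hP : 0 ≤ modelMask r κ t / t ^ i := by unfold modelMask; positivity
  calc _ ≤ modelMask r κ t / t ^ i * ((2 * t) ^ (r + i) * (2 * Real.log (t + 1)) ^ κ) := by
        unfold weight; gcongr
    _ = _ := by
        rw [modelMask, Real.mul_rpow zero_le_two ht0.le, Real.mul_rpow zero_le_two hl.le,
          Real.rpow_add ht0, Real.rpow_natCast, Real.rpow_neg ht0.le, Real.rpow_neg hl.le]
        field_simp

lemma exists_bound_of_symm {g w : ℝ → ℝ} (hg : Continuous g) (hw : Continuous w)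
    (hgw : ∀ t, |g (-t)| * w (-t) = |g t| * w t) {C : ℝ} (h : ∀ t, 3 ≤ t → |g t| * w t ≤ C) :
    ∃ M, ∀ t, |g t| * w t ≤ M := by
  obtain ⟨M, hM⟩ := (isCompact_Icc (a := (-3 : ℝ)) (b := 3)).exists_bound_of_continuousOn
    (f := fun t => |g t| * w t) (hg.abs.mul hw).continuousOn
  refine ⟨max C M, fun t => ?_⟩
  rcases le_total 3 t with h3 | h3
  · exact (h t h3).trans (le_max_left _ _)
  rcases le_total t (-3) with h4 | h4
  · rw [← hgw]
    exact (h _ (by linarith)).trans (le_max_left _ _)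
  · exact ((le_abs_self _).trans (hM t ⟨h4, h3⟩)).trans (le_max_right _ _)

/-- Extends `IsMask.bound_large` to the whole line: `lam` and `lam''` are even, `lam'` is odd, and
compactness covers `[-3, 3]`. -/
lemma IsMask.bound {r κ : ℝ} {lam : ℝ → ℝ} (h : IsMask r κ lam) (hr : 0 ≤ r) (hκ : 0 ≤ κ) :
    ∃ C, 0 ≤ C ∧ ∀ t, |lam t| * weight r κ t ≤ C ∧ |deriv lam t| * weight (r + 1) κ t ≤ C ∧
      |deriv (deriv lam) t| * weight (r + 2) κ t ≤ C := by
  obtain ⟨C, hC, hb⟩ := h.bound_large hr hκ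
  have hodd : ∀ t, deriv lam (-t) = -deriv lam t := fun t => by
    have e : (fun t => lam (-t)) = lam := funext h.even
    have := deriv_comp_neg lam t
    rw [e] at this
    linarith
  have heven : ∀ t, deriv (deriv lam) (-t) = deriv (deriv lam) t := fun t => by
    have e : (fun t => deriv lam (-t)) = fun t => -deriv lam t := funext hodd
    have := deriv_comp_neg (deriv lam) t
    rw [e, deriv.fun_neg] at this
    linarith
  have key : ∀ (g : ℝ → ℝ) (i : ℕ), (∀ t, 3 ≤ t → |g t| ≤ C * modelMask r κ t / t ^ i) →
      ∀ t, 3 ≤ t → |g t| * weight (r + i) κ t ≤ C * (2 ^ (r + i) * 2 ^ κ) := fun g i hg t ht => by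
    calc _ ≤ C * modelMask r κ t / t ^ i * weight (r + i) κ t := by
          have := weight_pos (r + i) κ t
          exact mul_le_mul_of_nonneg_right (hg t ht) this.le
      _ = C * (modelMask r κ t / t ^ i * weight (r + i) κ t) := by ring
      _ ≤ _ := by
          exact mul_le_mul_of_nonneg_left (modelMask_mul_weight_le hr hκ i ht) hC
  obtain ⟨M0, h0⟩ := exists_bound_of_symm h.contDiff.continuous (continuous_weight r κ)
    (fun t => by rw [h.even, weight_neg])
    (fun t ht => by simpa using key lam 0 (fun t ht => by simpa using (hb t ht).1) t ht)
  obtain ⟨M1, h1⟩ := exists_bound_of_symm (h.contDiff.continuous_deriv (by norm_num))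
    (continuous_weight (r + 1) κ) (fun t => by rw [hodd, weight_neg, abs_neg])
    (fun t ht => by simpa using key _ 1 (fun t ht => by simpa using (hb t ht).2.1) t ht)
  obtain ⟨M2, h2⟩ := exists_bound_of_symm (ContDiff.continuous_deriv_deriv h.contDiff)
    (continuous_weight (r + 2) κ) (fun t => by rw [heven, weight_neg])
    (fun t ht => by simpa using key _ 2 (fun t ht => (hb t ht).2.2) t ht)
  refine ⟨max 0 (max M0 (max M1 M2)), le_max_left _ _, fun t => ⟨(h0 t).trans ?_, (h1 t).trans ?_,
    (h2 t).trans ?_⟩⟩ <;> simp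

/-! ### High-frequency parts of masks -/

/-- The high-frequency part `lam t (1 - θ (t / m))` of `lam`. -/
def highPart (lam θ : ℝ → ℝ) (m : ℕ) (t : ℝ) : ℝ := lam t * (1 - θ (t / m))

lemma contDiff_highPart {lam θ : ℝ → ℝ} (hl : ContDiff ℝ 2 lam) (hθ : IsCutoff θ) (m : ℕ) :
    ContDiff ℝ 2 (highPart lam θ m) :=
  hl.mul (contDiff_const.sub (hθ.contDiff.comp (contDiff_id.div_const _)))

lemma highPart_eq_zero {lam θ : ℝ → ℝ} (hθ : IsCutoff θ) {m : ℕ} (hm : 1 ≤ m) {t : ℝ}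
    (ht : |t| ≤ m / 2) : highPart lam θ m t = 0 := by
  have hm' : (1 : ℝ) ≤ m := by exact_mod_cast hm
  rw [highPart, hθ.eq_one_of_le, sub_self, mul_zero]
  rw [abs_div, Nat.abs_cast, div_le_iff₀ (by linarith)]
  linarith

lemma deriv_deriv_highPart {lam θ : ℝ → ℝ} (hl : ContDiff ℝ 2 lam) (hθ : IsCutoff θ) (m : ℕ)
    (t : ℝ) : deriv (deriv (highPart lam θ m)) t = deriv (deriv lam) t * (1 - θ (t / m)) -
      2 * deriv lam t * (deriv θ (t / m) / m) - lam t * (deriv (deriv θ) (t / m) / m / m) := by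
  have hL := ContDiff.hasDerivAt_deriv hl
  have hT := deriv_comp_div hθ.contDiff m
  have e : deriv (highPart lam θ m) = fun t =>
      deriv lam t * (1 - θ (t / m)) - lam t * (deriv θ (t / m) / m) := funext fun t =>
    (((hL t).1.mul ((hT t).1.const_sub 1)).congr_deriv (by ring)).deriv
  rw [e]
  exact ((((hL t).2.mul ((hT t).1.const_sub 1)).sub ((hL t).1.mul ((hT t).2.div_const _))).congr_deriv
    (by ring)).deriv

lemma weight_add {s i κ t : ℝ} : weight (s + i) κ t = (1 + |t|) ^ i * weight s κ t := by
  have : 0 < 1 + |t| := by linarith [abs_nonneg t]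
  rw [weight, weight, Real.rpow_add this]; ring

/-- On the support `|t| ≤ m` one has `1/m ≤ 2/(1 + |t|)`. Each factor `1/m` produced by
differentiating `θ(t/m)` is thus traded for decay in `t`, which makes the bounds for the high part
uniform in `m`. -/
lemma abs_div_le_two_div {f : ℝ → ℝ} {M : ℝ} (hM : ∀ x, |f x| ≤ M)
    (h0 : ∀ x, 1 < |x| → f x = 0) {m : ℕ} (hm : 1 ≤ m) (t : ℝ) :
    |f (t / m)| / m ≤ 2 * M / (1 + |t|) ∧ |f (t / m)| / m / m ≤ 4 * M / (1 + |t|) ^ 2 := by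
  have hm' : (1 : ℝ) ≤ m := by exact_mod_cast hm
  have hm0 : (0 : ℝ) < m := by linarith
  have ht : 0 < 1 + |t| := by linarith [abs_nonneg t]
  have hM0 : 0 ≤ M := (abs_nonneg _).trans (hM 0)
  by_cases h : 1 < |t / m|
  · rw [h0 _ h]
    simp only [abs_zero, zero_div]
    constructor <;> positivity
  · have h1 : |t| ≤ m := by
      rw [abs_div, Nat.abs_cast, not_lt, div_le_iff₀ hm0] at h
      linarith
    have h2 : 1 / (m : ℝ) ≤ 2 / (1 + |t|) := by
      rw [div_le_div_iff₀ hm0 ht]; linarith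
    have hp : 0 ≤ 1 / (m : ℝ) := by positivity
    constructor
    · calc |f (t / m)| / m = |f (t / m)| * (1 / m) := by ring
        _ ≤ M * (2 / (1 + |t|)) := mul_le_mul (hM _) h2 hp hM0
        _ = _ := by ring
    · calc |f (t / m)| / m / m = |f (t / m)| * (1 / m) ^ 2 := by ring
        _ ≤ M * (2 / (1 + |t|)) ^ 2 := mul_le_mul (hM _) (by gcongr) (by positivity) hM0
        _ = _ := by rw [div_pow]; ring

lemma IsMask.bound_highPart {r κ : ℝ} {lam θ : ℝ → ℝ} (h : IsMask r κ lam) (hr : 0 ≤ r)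
    (hκ : 0 ≤ κ) (hθ : IsCutoff θ) :
    ∃ C, 0 ≤ C ∧ ∀ m : ℕ, 1 ≤ m → ∀ t, |highPart lam θ m t| * weight r κ t ≤ C ∧
      |deriv (deriv (highPart lam θ m)) t| * weight (r + 2) κ t ≤ C := by
  obtain ⟨C, hC, hb⟩ := h.bound hr hκ
  obtain ⟨M, hM1, hM⟩ := hθ.exists_bound
  -- `10 = 2 + 4 + 4`, from the three terms of the Leibniz formula for the second derivative.
  refine ⟨10 * M * C, by positivity, fun m hm t => ?_⟩
  obtain ⟨b0, b1, b2⟩ := hb t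
  have h1θ : |1 - θ (t / m)| ≤ 2 * M := by
    have := abs_sub 1 (θ (t / m))
    rw [abs_one] at this
    linarith [(hM (t / m)).1]
  have hMC : 0 ≤ M * C := by positivity
  have ht : 0 < 1 + |t| := by linarith [abs_nonneg t]
  have w0 := weight_pos r κ t
  have w1 := weight_pos (r + 1) κ t
  have w2 := weight_pos (r + 2) κ t
  constructor
  · rw [highPart, abs_mul]
    calc _ = |1 - θ (t / m)| * (|lam t| * weight r κ t) := by ring
      _ ≤ 2 * M * C := by gcongr
      _ ≤ 10 * M * C := by nlinarith
  · rw [deriv_deriv_highPart h.contDiff hθ]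
    have d1 := (abs_div_le_two_div (fun x => (hM x).2.1) (fun x hx => (hθ.deriv_eq_zero hx).1) hm t).1
    have d2 := (abs_div_le_two_div (fun x => (hM x).2.2) (fun x hx => (hθ.deriv_eq_zero hx).2) hm t).2
    have e1 : weight (r + 2) κ t = (1 + |t|) * weight (r + 1) κ t := by
      rw [show r + 2 = (r + 1) + 1 by ring, weight_add, Real.rpow_one]
    have e2 : weight (r + 2) κ t = (1 + |t|) ^ 2 * weight r κ t := by
      rw [weight_add]; norm_num
    calc _ ≤ (|deriv (deriv lam) t| * |1 - θ (t / m)| +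
          2 * |deriv lam t| * (|deriv θ (t / m)| / m) +
          |lam t| * (|deriv (deriv θ) (t / m)| / m / m)) * weight (r + 2) κ t := by
          refine mul_le_mul_of_nonneg_right ?_ w2.le
          refine (abs_sub _ _).trans (add_le_add ((abs_sub _ _).trans (add_le_add ?_ ?_)) ?_)
          · rw [abs_mul]
          · rw [abs_mul, abs_mul, abs_div, Nat.abs_cast, abs_two]
          · rw [abs_mul, abs_div, abs_div, Nat.abs_cast]
      _ ≤ (|deriv (deriv lam) t| * (2 * M) +
          2 * |deriv lam t| * (2 * M / (1 + |t|)) +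
          |lam t| * (4 * M / (1 + |t|) ^ 2)) * weight (r + 2) κ t := by gcongr
      _ = 2 * M * (|deriv (deriv lam) t| * weight (r + 2) κ t) +
          4 * M * (|deriv lam t| * weight (r + 1) κ t) + 4 * M * (|lam t| * weight r κ t) := by
          rw [add_mul, add_mul]
          congr 1
          · congr 1
            · ring
            · rw [e1]; field_simp; ring
          · rw [e2]; field_simp
      _ ≤ 2 * M * C + 4 * M * C + 4 * M * C := by gcongr
      _ = _ := by ring

/-- The factor `4` serves `l = log (m + 2)`: one doubling passes from `m` to an index `j` with `m/2
≤ 1 + |j|`, another from `j` to a point within distance `1` of it. -/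
lemma le_of_weight {s κ y : ℝ} (hκ : 0 ≤ κ) {C x l : ℝ} (hl : 0 < l)
    (hly : l ≤ 4 * Real.log (|y| + 2)) (h : |x| * weight s κ y ≤ C) :
    |x| ≤ 4 ^ κ * C * l ^ (-κ) * (1 + |y|) ^ (-s) := by
  have hy : 0 < 1 + |y| := by linarith [abs_nonneg y]
  have hL := log_abs_add_two_pos y
  have h1 : l ^ κ ≤ 4 ^ κ * Real.log (|y| + 2) ^ κ := by
    rw [← Real.mul_rpow (by norm_num) hL.le]
    exact Real.rpow_le_rpow hl.le hly hκ
  rw [Real.rpow_neg hl.le, Real.rpow_neg hy.le, ← div_eq_mul_inv, ← div_eq_mul_inv, div_div,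
    le_div_iff₀ (by positivity)]
  calc |x| * (l ^ κ * (1 + |y|) ^ s) ≤ |x| * (4 ^ κ * Real.log (|y| + 2) ^ κ * (1 + |y|) ^ s) := by
        gcongr
    _ = 4 ^ κ * (|x| * weight s κ y) := by unfold weight; ring
    _ ≤ _ := by gcongr

lemma log_le_of_half_le {m : ℕ} {y : ℝ} (hy : (m : ℝ) / 2 ≤ 1 + y) (hy0 : 0 ≤ y) :
    Real.log ((m : ℝ) + 2) ≤ 2 * Real.log (y + 2) := by
  rw [← Nat.cast_two, ← Real.log_pow]
  exact Real.log_le_log (by positivity) (by push_cast; nlinarith)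

lemma summable_and_tsum_le_of_tail {b : ℤ → ℝ} {A s : ℝ} (hs : 1 < s) {m : ℕ} (hm : 1 ≤ m)
    (hA : 0 ≤ A) (h0 : ∀ j : ℤ, 1 + |(j : ℝ)| < (m : ℝ) / 2 → b j = 0)
    (hb : ∀ j : ℤ, (m : ℝ) / 2 ≤ 1 + |(j : ℝ)| → |b j| ≤ A * (1 + |(j : ℝ)|) ^ (-s)) :
    (Summable fun j => |b j|) ∧
      ∑' j, |b j| ≤ A * (3 ^ s * (2 / (s - 1)) * (m : ℝ) ^ (1 - s)) := by
  obtain ⟨hsum, hle⟩ := tail_rpow_le hs hm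
  have hb' : ∀ j : ℤ, |b j| ≤
      A * (if (m : ℝ) / 2 ≤ 1 + |(j : ℝ)| then (1 + |(j : ℝ)|) ^ (-s) else 0) := fun j => by
    split_ifs with hj
    · exact hb j hj
    · rw [h0 j (not_le.1 hj)]; simp
  have h1 := hsum.mul_left A
  have h2 := h1.of_nonneg_of_le (fun j => abs_nonneg (b j)) hb'
  refine ⟨h2, (h2.tsum_le_tsum hb' h1).trans ?_⟩
  rw [tsum_mul_left]
  gcongr

/-- The rate `m^{-r} (log (m + 2))^{-κ}`. -/
def rate (r κ : ℝ) (m : ℕ) : ℝ := (m : ℝ) ^ (-r) * Real.log ((m : ℝ) + 2) ^ (-κ)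

/-- The coefficients and their second differences vanish for `1 + |j| < m/2` and decay like
`|j|^{-r}` and `|j|^{-r-2}`, up to the logarithm. Their tails sum to orders `m^{1-r}` and
`m^{-1-r}`, which are `m` and `1/m` times `m^{-r}`. -/
lemma IsMask.coeffBound_highPart {r κ : ℝ} {lam θ : ℝ → ℝ} (h : IsMask r κ lam) (hr : 1 < r)
    (hκ : 0 ≤ κ) (hθ : IsCutoff θ) :
    ∃ B, 0 ≤ B ∧ ∀ m : ℕ, 1 ≤ m →
      CoeffBound (fun j : ℤ => highPart lam θ m j) (B * rate r κ m) m := by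
  obtain ⟨C, hC, hb⟩ := h.bound_highPart (by linarith) hκ hθ
  set D0 : ℝ := 4 ^ κ * C * (3 ^ r * (2 / (r - 1))) with hD0
  set D2 : ℝ := 4 ^ κ * (2 ^ (r + 2) * C) * (3 ^ (r + 2) * (2 / (r + 2 - 1))) with hD2
  have hr1 : 0 < r - 1 := by linarith
  have hD00 : 0 ≤ D0 := by positivity
  have hD20 : 0 ≤ D2 := by
    have : 0 < r + 2 - 1 := by linarith
    positivity
  refine ⟨max D0 D2, hD00.trans (le_max_left _ _), fun m hm => ?_⟩
  have hm' : (1 : ℝ) ≤ m := by exact_mod_cast hm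
  have hm0 : (0 : ℝ) < m := by linarith
  set l := Real.log ((m : ℝ) + 2) with hl
  have hl0 : 0 < l := Real.log_pos (by linarith)
  have s0 := summable_and_tsum_le_of_tail (b := fun j : ℤ => highPart lam θ m j)
    (A := 4 ^ κ * C * l ^ (-κ)) hr hm (by positivity)
    (fun j hj => highPart_eq_zero hθ hm (by linarith))
    (fun j hj => le_of_weight hκ hl0 (by
      have := log_le_of_half_le hj (abs_nonneg _)
      linarith [log_abs_add_two_pos (j : ℝ)]) (hb m hm j).1)
  have s2 := summable_and_tsum_le_of_tail (b := secondDiff fun j : ℤ => highPart lam θ m j)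
    (A := 4 ^ κ * (2 ^ (r + 2) * C) * l ^ (-κ)) (s := r + 2) (by linarith) hm (by positivity)
    (fun j hj => by
      have e1 := abs_add_le (j : ℝ) 1
      have e2 := abs_sub (j : ℝ) 1
      rw [abs_one] at e1 e2
      simp only [secondDiff]
      push_cast
      rw [highPart_eq_zero hθ hm (by linarith), highPart_eq_zero hθ hm (by linarith),
        highPart_eq_zero hθ hm (by linarith)]
      ring)
    (fun j hj => by
      simp only [secondDiff]
      push_cast
      refine abs_second_difference_le (contDiff_highPart h.contDiff hθ m) fun t ht => ?_
      have hjt : |(j : ℝ)| ≤ |t| + 1 := by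
        have h1 : |(j : ℝ) - t| ≤ 1 := by rw [abs_le]; constructor <;> linarith [ht.1, ht.2]
        have := abs_sub_abs_le_abs_sub (j : ℝ) t
        linarith
      have ht0 := abs_nonneg t
      have hj0 := abs_nonneg (j : ℝ)
      have k1 : Real.log (|(j : ℝ)| + 2) ≤ 2 * Real.log (|t| + 2) := by
        rw [← Nat.cast_two, ← Real.log_pow]
        exact Real.log_le_log (by positivity) (by push_cast; nlinarith)
      have k2 := log_le_of_half_le hj hj0
      refine (le_of_weight hκ hl0 (by linarith) (hb m hm t).2).trans ?_
      -- The derivative bound holds at `t`, the sum runs over `j`; `1 + |j| ≤ 2 (1 + |t|)` moves one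
      -- to the other.
      have k3 : (1 + |t|) ^ (-(r + 2)) ≤ 2 ^ (r + 2) * (1 + |(j : ℝ)|) ^ (-(r + 2)) := by
        rw [Real.rpow_neg (by positivity), Real.rpow_neg (by positivity), ← div_eq_mul_inv,
          ← Real.div_rpow (by positivity) (by positivity), ← Real.inv_rpow (by positivity)]
        refine Real.rpow_le_rpow (by positivity) ?_ (by linarith)
        rw [inv_eq_one_div, div_le_div_iff₀ (by positivity) (by positivity)]
        linarith
      calc _ ≤ 4 ^ κ * C * l ^ (-κ) * (2 ^ (r + 2) * (1 + |(j : ℝ)|) ^ (-(r + 2))) := by gcongr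
        _ = _ := by ring)
  have hR : 0 ≤ rate r κ m := by unfold rate; positivity
  refine ⟨s0.1, s0.2.trans ?_, s2.2.trans ?_⟩
  · calc _ = D0 * rate r κ m * m := by
          rw [hD0, rate, show 1 - r = -r + 1 by ring, Real.rpow_add hm0, Real.rpow_one]; ring
      _ ≤ _ := by gcongr; exact le_max_left _ _
  · calc _ = D2 * rate r κ m / m := by
          rw [hD2, rate, show 1 - (r + 2) = -r + (-1) by ring, Real.rpow_add hm0,
            Real.rpow_neg_one]
          ring
      _ ≤ _ := by gcongr; exact le_max_right _ _

lemma IsMask.summable {r κ : ℝ} {lam : ℝ → ℝ} (h : IsMask r κ lam) (hr : 1 < r)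
    (hκ : 0 ≤ κ) : Summable fun j : ℤ => |lam j| := by
  obtain ⟨C, hC, hb⟩ := h.bound (by linarith) hκ
  have hl : 0 < Real.log 2 := Real.log_pos (by norm_num)
  -- For `m = 1` the tail condition `1/2 ≤ 1 + |j|` holds for every `j`, so the tail is the full
  -- series.
  exact (summable_and_tsum_le_of_tail (b := fun j : ℤ => lam j) (m := 1)
    (A := 4 ^ κ * C * (Real.log 2) ^ (-κ)) hr le_rfl (by positivity)
    (fun j hj => by
      have := abs_nonneg (j : ℝ)
      norm_num at hj
      linarith)
    (fun j _ => le_of_weight hκ hl (by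
      have h1 : Real.log 2 ≤ Real.log (|(j : ℝ)| + 2) :=
        Real.log_le_log (by norm_num) (by linarith [abs_nonneg (j : ℝ)])
      linarith) (hb j).1)).1

/-! ### Kernels of the univariate operators -/

/-- The kernel of the operator `opQ`. -/
def kernelQ (θ lam : ℝ → ℝ) (m : ℕ) (x y : Torus) : ℂ :=
  (1 / (2 * (m : ℂ) + 1)) * ∑ s ∈ Finset.range (2 * m + 1),
    trigSeries (fun j : ℤ => θ ((j : ℝ) / m)) (node m s - y) * phi lam (x - node m s)

/-- The difference between the kernel of the identity and that of `opQ`. -/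
def kernelErr (θ lam : ℝ → ℝ) (m : ℕ) (x y : Torus) : ℂ :=
  trigSeries (fun j : ℤ => highPart lam (fun t => θ t ^ 2) m j) (x - y) -
    (1 / (2 * (m : ℂ) + 1)) * ∑ s ∈ Finset.range (2 * m + 1),
      trigSeries (fun j : ℤ => θ ((j : ℝ) / m)) (node m s - y) *
        trigSeries (fun j : ℤ => highPart lam θ m j) (x - node m s)

lemma trigSeries_eq_sum {a : ℤ → ℝ} {m : ℕ} (ha : ∀ j : ℤ, (m : ℤ) ≤ |j| → a j = 0) (x : Torus) :
    trigSeries a x = ∑ j ∈ Finset.Icc (-(m : ℤ)) m, (a j : ℂ) * fourier j x :=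
  tsum_eq_sum fun j hj => by
    rw [ha j, Complex.ofReal_zero, zero_mul]
    by_contra hlt
    exact hj (Finset.mem_Icc.2 (abs_le.1 (not_le.1 hlt).le))

/-- Exactness of the quadrature: the frequencies `k` and `j` differ by at most `2m < 2m+1`, so the
average of `e^{i(k-j)t_s}` is zero unless `k = j`. -/
lemma mean_mul_trigSeries {a b : ℤ → ℝ} {m : ℕ} (ha : ∀ j : ℤ, (m : ℤ) ≤ |j| → a j = 0)
    (hb : ∀ j : ℤ, (m : ℤ) ≤ |j| → b j = 0) (x y : Torus) :
    (1 / (2 * (m : ℂ) + 1)) * ∑ s ∈ Finset.range (2 * m + 1),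
      trigSeries a (node m s - y) * trigSeries b (x - node m s) =
    trigSeries (fun j => b j * a j) (x - y) := by
  have hN : (2 * (m : ℂ) + 1) ≠ 0 := by exact_mod_cast (Nat.succ_ne_zero (2 * m))
  rw [trigSeries_eq_sum (a := fun j => b j * a j) (m := m) fun j hj => by rw [ha j hj, mul_zero]]
  simp_rw [trigSeries_eq_sum ha, trigSeries_eq_sum hb, Finset.sum_mul_sum]
  rw [Finset.sum_comm, Finset.mul_sum]
  refine Finset.sum_congr rfl fun k hk => ?_
  rw [Finset.sum_comm, Finset.mul_sum, Finset.sum_eq_single k]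
  · have e : ∀ s, (a k : ℂ) * fourier k (node m s - y) * ((b k : ℂ) * fourier k (x - node m s)) =
        ((b k * a k : ℝ) : ℂ) * fourier k (x - y) := fun s => by
      have : x - y = (node m s - y) + (x - node m s) := by abel
      rw [this, fourier_add_apply]; push_cast; ring
    rw [Finset.sum_congr rfl fun s _ => e s, Finset.sum_const, Finset.card_range, nsmul_eq_mul]
    push_cast
    field_simp
  · intro j hj hjk
    have e : ∀ s, (a k : ℂ) * fourier k (node m s - y) * ((b j : ℂ) * fourier j (x - node m s)) =
        (a k : ℂ) * b j * fourier (-k) y * fourier j x * fourier (k - j) (node m s) := fun s => by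
      rw [fourier_sub_apply, fourier_sub_apply, sub_eq_add_neg k j, fourier_add]; ring
    rw [Finset.sum_congr rfl fun s _ => e s, ← Finset.mul_sum, sum_fourier_node, if_neg]
    · ring
    · rintro ⟨c, hc⟩
      rw [Finset.mem_Icc] at hk hj
      have hc0 : c = 0 := by
        by_contra h0
        rcases lt_or_gt_of_ne h0 with h | h <;> nlinarith
      rw [hc0, mul_zero] at hc
      exact hjk (by linarith)
  · intro h; exact absurd hk h

lemma cutoff_vanish {θ : ℝ → ℝ} (hθ : IsCutoff θ) {m : ℕ} (hm : 1 ≤ m) {j : ℤ}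
    (hj : (m : ℤ) ≤ |j|) : θ ((j : ℝ) / m) = 0 := by
  have hm' : (1 : ℝ) ≤ m := by exact_mod_cast hm
  refine hθ.eq_zero_of_le ?_
  rw [abs_div, Nat.abs_cast, le_div_iff₀ (by linarith), one_mul]
  exact_mod_cast hj

lemma summable_abs_of_vanish {a : ℤ → ℝ} {m : ℕ} (ha : ∀ j : ℤ, (m : ℤ) ≤ |j| → a j = 0) :
    Summable fun j => |a j| :=
  summable_of_ne_finset_zero (s := Finset.Icc (-(m : ℤ)) m) fun j hj => by
    rw [ha j, abs_zero]
    by_contra hlt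
    exact hj (Finset.mem_Icc.2 (abs_le.1 (not_le.1 hlt).le))

/-- The low-frequency part and the high-frequency part of the series of `lam` add up to it. -/
lemma phi_eq_low_add_high {lam θ : ℝ → ℝ} (hθ : IsCutoff θ)
    {m : ℕ} (hm : 1 ≤ m) (hsh : Summable fun j : ℤ => |highPart lam θ m j|) (x : Torus) :
    phi lam x = trigSeries (fun j : ℤ => lam j * θ ((j : ℝ) / m)) x +
      trigSeries (fun j : ℤ => highPart lam θ m j) x := by
  rw [← trigSeries_add (summable_abs_of_vanish (m := m) fun j hj => by
    rw [cutoff_vanish hθ hm hj, mul_zero]) hsh]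
  refine tsum_congr fun j => ?_
  congr 2
  unfold highPart; ring

/-- Splitting `phi` inside the node average, the low part is reproduced exactly with coefficients `λ
θ²`. Subtracting it from the full series leaves the high part for the cut-off `θ²`. -/
lemma kernelErr_eq {lam θ : ℝ → ℝ} (hθ : IsCutoff θ)
    {m : ℕ} (hm : 1 ≤ m) (hsh : Summable fun j : ℤ => |highPart lam θ m j|)
    (hsh2 : Summable fun j : ℤ => |highPart lam (fun t => θ t ^ 2) m j|) (x y : Torus) :
    kernelErr θ lam m x y = phi lam (x - y) - kernelQ θ lam m x y := by
  have hv : ∀ j : ℤ, (m : ℤ) ≤ |j| → lam j * θ ((j : ℝ) / m) = 0 := fun j hj => by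
    rw [cutoff_vanish hθ hm hj, mul_zero]
  rw [kernelErr, kernelQ, phi_eq_low_add_high hθ.sq hm hsh2]
  simp_rw [phi_eq_low_add_high hθ hm hsh, mul_add]
  rw [Finset.sum_add_distrib, mul_add,
    mean_mul_trigSeries (fun j hj => cutoff_vanish hθ hm hj) hv]
  have : (fun j : ℤ => lam j * θ ((j : ℝ) / m) ^ 2) =
      fun j : ℤ => lam j * θ ((j : ℝ) / m) * θ ((j : ℝ) / m) := by ext j; ring
  rw [this]; ring

/-- A continuous kernel whose `L¹` norms in each of its variables are at most `A`. -/
structure SchurBound (K : Torus → Torus → ℂ) (A : ℝ) : Prop where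
  cont : Continuous fun z : Torus × Torus => K z.1 z.2
  left : ∀ x, ∫ y, ‖K x y‖ ∂circleMeasure ≤ A
  right : ∀ y, ∫ x, ‖K x y‖ ∂circleMeasure ≤ A

lemma SchurBound.cont_left {K : Torus → Torus → ℂ} {A : ℝ} (h : SchurBound K A) (x : Torus) :
    Continuous (K x) := h.cont.comp (Continuous.prodMk_right x)

lemma SchurBound.cont_right {K : Torus → Torus → ℂ} {A : ℝ} (h : SchurBound K A) (y : Torus) :
    Continuous fun x => K x y := h.cont.comp (Continuous.prodMk_left y)

lemma SchurBound.mono {K : Torus → Torus → ℂ} {A B : ℝ} (h : SchurBound K A) (hAB : A ≤ B) :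
    SchurBound K B :=
  ⟨h.cont, fun x => (h.left x).trans hAB, fun y => (h.right y).trans hAB⟩

lemma integral_norm_sub_le {f g : Torus → ℂ} (hf : Continuous f) (hg : Continuous g) :
    ∫ x, ‖f x - g x‖ ∂circleMeasure ≤
      ∫ x, ‖f x‖ ∂circleMeasure + ∫ x, ‖g x‖ ∂circleMeasure := by
  rw [← integral_add (integrable_of_continuous hf.norm) (integrable_of_continuous hg.norm)]
  exact integral_mono (integrable_of_continuous (hf.sub hg).norm)
    (integrable_of_continuous (hf.norm.add hg.norm)) fun x => norm_sub_le _ _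

lemma SchurBound.sub {K L : Torus → Torus → ℂ} {A B : ℝ} (hK : SchurBound K A)
    (hL : SchurBound L B) : SchurBound (fun x y => K x y - L x y) (A + B) where
  cont := hK.cont.sub hL.cont
  left x := (integral_norm_sub_le (hK.cont_left x) (hL.cont_left x)).trans
    (add_le_add (hK.left x) (hL.left x))
  right y := (integral_norm_sub_le (hK.cont_right y) (hL.cont_right y)).trans
    (add_le_add (hK.right y) (hL.right y))

lemma SchurBound.of_norm_le {K : Torus → Torus → ℂ} {A : ℝ}
    (hc : Continuous fun z : Torus × Torus => K z.1 z.2) (h : ∀ x y, ‖K x y‖ ≤ A) :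
    SchurBound K A := by
  have key : ∀ f : Torus → ℂ, Continuous f → (∀ x, ‖f x‖ ≤ A) →
      ∫ x, ‖f x‖ ∂circleMeasure ≤ A := fun f hf hA => by
    calc _ ≤ ∫ _ : Torus, A ∂circleMeasure :=
          integral_mono (integrable_of_continuous hf.norm) (integrable_const _) hA
      _ = A := by simp
  exact ⟨hc, fun x => key _ (hc.comp (Continuous.prodMk_right x)) (h x),
    fun y => key _ (hc.comp (Continuous.prodMk_left y)) fun x => h x y⟩

lemma SchurBound.nonneg {K : Torus → Torus → ℂ} {A : ℝ} (h : SchurBound K A) : 0 ≤ A :=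
  (integral_nonneg fun _ => norm_nonneg _).trans (h.left 0)

lemma SchurBound.of_trigSeries {a : ℤ → ℝ} {B : ℝ} {m : ℕ} (h : CoeffBound a B m) (hm : 1 ≤ m) :
    SchurBound (fun x y => trigSeries a (x - y)) (6 * B) where
  cont := (continuous_trigSeries h.summable).comp (continuous_fst.sub continuous_snd)
  left x := by
    rw [integral_sub_left_eq_self (fun x => ‖trigSeries a x‖) circleMeasure x]
    exact h.integral_le hm
  right y := by
    rw [integral_sub_right_eq_self (fun x => ‖trigSeries a x‖) y]
    exact h.integral_le hm

/-- The kernel `N⁻¹ ∑_s u (t_s - y) v (x - t_s)` with `N = 2 m + 1` and `t_s` the nodes. -/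
lemma SchurBound.of_mean {a b : ℤ → ℝ} {A B : ℝ} {m : ℕ} (ha : CoeffBound a A m)
    (hb : CoeffBound b B m) (hm : 1 ≤ m) :
    SchurBound (fun x y => (1 / (2 * (m : ℂ) + 1)) * ∑ s ∈ Finset.range (2 * m + 1),
      trigSeries a (node m s - y) * trigSeries b (x - node m s)) (36 * A * B) := by
  have hA := ha.nonneg hm
  have hB := hb.nonneg hm
  have ca := continuous_trigSeries ha.summable
  have cb := continuous_trigSeries hb.summable
  have hn : ∀ x y, ‖(1 / (2 * (m : ℂ) + 1)) * ∑ s ∈ Finset.range (2 * m + 1),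
      trigSeries a (node m s - y) * trigSeries b (x - node m s)‖ ≤
      (1 / (2 * (m : ℝ) + 1)) * ∑ s ∈ Finset.range (2 * m + 1),
        ‖trigSeries a (node m s - y)‖ * ‖trigSeries b (x - node m s)‖ := fun x y => by
    rw [norm_mul]
    have e : ‖(1 / (2 * (m : ℂ) + 1))‖ = 1 / (2 * (m : ℝ) + 1) := by
      rw [norm_div, norm_one]
      congr 1
      have : (2 * (m : ℂ) + 1) = ((2 * m + 1 : ℕ) : ℂ) := by push_cast; rfl
      rw [this, Complex.norm_natCast]; push_cast; rfl
    rw [e]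
    gcongr
    refine (norm_sum_le _ _).trans_eq (Finset.sum_congr rfl fun s _ => norm_mul _ _)
  have hcont : Continuous fun z : Torus × Torus => (1 / (2 * (m : ℂ) + 1)) *
      ∑ s ∈ Finset.range (2 * m + 1),
        trigSeries a (node m s - z.2) * trigSeries b (z.1 - node m s) :=
    continuous_const.mul (continuous_finsetSum _ fun s _ =>
      (ca.comp (continuous_const.sub continuous_snd)).mul
        (cb.comp (continuous_fst.sub continuous_const)))
  -- Integration in one variable turns one factor into its `L¹` norm and leaves the discrete mean of
  -- the other; these are at most `6A` and `6B` in some order.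
  refine ⟨hcont, fun x => ?_, fun y => ?_⟩
  · have hi : ∀ s, Integrable (fun y => ‖trigSeries a (node m s - y)‖ *
        ‖trigSeries b (x - node m s)‖) circleMeasure := fun s =>
      (integrable_of_continuous (ca.comp (continuous_sub_left _)).norm).mul_const _
    calc _ ≤ ∫ y, (1 / (2 * (m : ℝ) + 1)) * ∑ s ∈ Finset.range (2 * m + 1),
          ‖trigSeries a (node m s - y)‖ * ‖trigSeries b (x - node m s)‖ ∂circleMeasure :=
          integral_mono (integrable_of_continuous
            (hcont.comp (Continuous.prodMk_right x)).norm)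
            ((integrable_finsetSum _ fun s _ => hi s).const_mul _) fun y => hn x y
      _ = (1 / (2 * (m : ℝ) + 1)) * ∑ s ∈ Finset.range (2 * m + 1),
          (∫ z, ‖trigSeries a z‖ ∂circleMeasure) * ‖trigSeries b (x - node m s)‖ := by
          rw [integral_const_mul, integral_finsetSum _ fun s _ => hi s]
          simp_rw [integral_mul_const,
            integral_sub_left_eq_self (fun x => ‖trigSeries a x‖) circleMeasure]
      _ = (∫ z, ‖trigSeries a z‖ ∂circleMeasure) * ((1 / (2 * (m : ℝ) + 1)) *
          ∑ s ∈ Finset.range (2 * m + 1), ‖trigSeries b (x - node m s)‖) := by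
          rw [← Finset.mul_sum]; ring
      _ ≤ (6 * A) * (6 * B) := mul_le_mul (ha.integral_le hm) (hb.mean_le' hm x)
          (by positivity) (by positivity)
      _ = _ := by ring
  · have hi : ∀ s, Integrable (fun x => ‖trigSeries a (node m s - y)‖ *
        ‖trigSeries b (x - node m s)‖) circleMeasure := fun s =>
      (integrable_of_continuous (cb.comp (continuous_sub_right _)).norm).const_mul _
    calc _ ≤ ∫ x, (1 / (2 * (m : ℝ) + 1)) * ∑ s ∈ Finset.range (2 * m + 1),
          ‖trigSeries a (node m s - y)‖ * ‖trigSeries b (x - node m s)‖ ∂circleMeasure :=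
          integral_mono (integrable_of_continuous
            (hcont.comp (Continuous.prodMk_left y)).norm)
            ((integrable_finsetSum _ fun s _ => hi s).const_mul _) fun x => hn x y
      _ = (1 / (2 * (m : ℝ) + 1)) * ∑ s ∈ Finset.range (2 * m + 1),
          ‖trigSeries a (node m s - y)‖ * (∫ z, ‖trigSeries b z‖ ∂circleMeasure) := by
          rw [integral_const_mul, integral_finsetSum _ fun s _ => hi s]
          simp_rw [integral_const_mul,
            integral_sub_right_eq_self (fun x => ‖trigSeries b x‖)]
      _ = ((1 / (2 * (m : ℝ) + 1)) *
          ∑ s ∈ Finset.range (2 * m + 1), ‖trigSeries a (node m s - y)‖) *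
            (∫ z, ‖trigSeries b z‖ ∂circleMeasure) := by
          rw [← Finset.sum_mul]; ring
      _ ≤ (6 * A) * (6 * B) := mul_le_mul (ha.mean_le hm y) (hb.integral_le hm)
          (integral_nonneg fun _ => norm_nonneg _) (by positivity)
      _ = _ := by ring

/-- A sup bound, worse than the `L¹` bound by a factor `m`, but enough for uniform convergence of
the kernels. -/
lemma norm_mean_le {a b : ℤ → ℝ} {A B : ℝ} {m : ℕ} (ha : CoeffBound a A m)
    (hb : CoeffBound b B m) (hm : 1 ≤ m) (x y : Torus) :
    ‖(1 / (2 * (m : ℂ) + 1)) * ∑ s ∈ Finset.range (2 * m + 1),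
      trigSeries a (node m s - y) * trigSeries b (x - node m s)‖ ≤ 6 * A * (B * m) := by
  have hB := hb.nonneg hm
  rw [norm_mul]
  have e : ‖(1 / (2 * (m : ℂ) + 1))‖ = 1 / (2 * (m : ℝ) + 1) := by
    rw [norm_div, norm_one]
    congr 1
    have : (2 * (m : ℂ) + 1) = ((2 * m + 1 : ℕ) : ℂ) := by push_cast; rfl
    rw [this, Complex.norm_natCast]; push_cast; rfl
  rw [e]
  calc _ ≤ (1 / (2 * (m : ℝ) + 1)) * ∑ s ∈ Finset.range (2 * m + 1),
        ‖trigSeries a (node m s - y)‖ * (B * m) := by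
        gcongr
        refine (norm_sum_le _ _).trans (Finset.sum_le_sum fun s _ => ?_)
        rw [norm_mul]
        gcongr
        exact (norm_trigSeries_le hb.summable _).trans hb.sum_le
    _ = ((1 / (2 * (m : ℝ) + 1)) * ∑ s ∈ Finset.range (2 * m + 1),
        ‖trigSeries a (node m s - y)‖) * (B * m) := by rw [← Finset.sum_mul]; ring
    _ ≤ _ := mul_le_mul_of_nonneg_right (ha.mean_le hm y) (by positivity)

/-! ### Densities -/

lemma conv_eq_integral (u v : Torus → ℂ) (x : Torus) :
    conv u v x = ∫ t, u (x - t) * v t ∂circleMeasure := convolution_mul_swap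

/-- Shows that the convolution depends on `G` only through its Fourier coefficients. -/
lemma conv_trigSeries {a : ℤ → ℝ} (ha : Summable fun j => |a j|) {G : Torus → ℂ}
    (hG : Integrable G circleMeasure) (x : Torus) :
    conv (trigSeries a) G x = ∑' j : ℤ, ((a j : ℂ) * fourierCoeff G j) * fourier j x := by
  rw [conv_eq_integral]
  have hF : ∀ j : ℤ, Integrable (fun t => (a j : ℂ) * fourier j (x - t) * G t) circleMeasure :=
    fun j => hG.bdd_mul (c := |a j|) (continuous_const.mul
      ((fourier j).continuous.comp (continuous_sub_left x))).aestronglyMeasurable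
      (ae_of_all _ fun t => (norm_coeff_mul_fourier a j _).le)
  have hn : ∀ j : ℤ, ∫ t, ‖(a j : ℂ) * fourier j (x - t) * G t‖ ∂circleMeasure =
      |a j| * ∫ t, ‖G t‖ ∂circleMeasure := fun j => by
    rw [← integral_const_mul]
    refine integral_congr_ae (ae_of_all _ fun t => ?_)
    simp only
    rw [norm_mul, norm_coeff_mul_fourier]
  have h := hasSum_integral_of_summable_integral_norm hF (by
    simp_rw [hn]; exact ha.mul_right _)
  have e : ∀ t, ∑' j : ℤ, (a j : ℂ) * fourier j (x - t) * G t = trigSeries a (x - t) * G t :=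
    fun t => tsum_mul_right
  simp_rw [e] at h
  rw [← h.tsum_eq]
  refine tsum_congr fun j => ?_
  have : (fun t => (a j : ℂ) * fourier j (x - t) * G t) =
      fun t => ((a j : ℂ) * fourier j x) * (fourier (-j) t • G t) := by
    funext t; rw [fourier_sub_apply, smul_eq_mul]; ring
  rw [this, integral_const_mul]
  unfold fourierCoeff
  ring

lemma norm_fourierCoeff_le {G : Torus → ℂ} (j : ℤ) :
    ‖fourierCoeff G j‖ ≤ ∫ t, ‖G t‖ ∂circleMeasure := by
  refine (norm_integral_le_integral_norm _).trans_eq (integral_congr_ae (ae_of_all _ fun t => ?_))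
  simp only
  rw [norm_smul, norm_fourier_apply, one_mul]

lemma fourierCoeff_tsum {b : ℤ → ℂ} (hb : Summable fun j => ‖b j‖) (k : ℤ) :
    fourierCoeff (fun x : Torus => ∑' j : ℤ, b j * fourier j x) k = b k := by
  unfold fourierCoeff
  have hn : ∀ (j : ℤ) (x : Torus), ‖fourier (-k) x • (b j * fourier j x)‖ = ‖b j‖ := fun j x => by
    rw [norm_smul, norm_mul, norm_fourier_apply, norm_fourier_apply, one_mul, mul_one]
  have hF : ∀ j : ℤ, Integrable (fun x : Torus => fourier (-k) x • (b j * fourier j x))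
      circleMeasure := fun j => integrable_of_continuous
    ((fourier (-k)).continuous.smul (continuous_const.mul (fourier j).continuous))
  have h := hasSum_integral_of_summable_integral_norm hF (by simpa only [hn, integral_const,
    probReal_univ, one_smul] using hb)
  have e : ∀ x : Torus, ∑' j : ℤ, fourier (-k) x • (b j * fourier j x) =
      fourier (-k) x • ∑' j : ℤ, b j * fourier j x := fun x => by
    simp only [smul_eq_mul]; exact tsum_mul_left
  simp_rw [e] at h
  rw [← h.tsum_eq]
  have hv : ∀ j : ℤ, ∫ x : Torus, fourier (-k) x • (b j * fourier j x) ∂circleMeasure =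
      if j = k then b k else 0 := fun j => by
    have h1 : ∫ x : Torus, fourier (-k) x • (b j * fourier j x) ∂circleMeasure =
        b j * fourierCoeff (T := 2 * Real.pi) (fourier j) k := by
      unfold fourierCoeff
      rw [← integral_const_mul]
      refine integral_congr_ae (ae_of_all _ fun x => ?_)
      simp only [smul_eq_mul]; ring
    rw [h1, fourierCoeff_fourier, Pi.single_apply]
    by_cases hjk : j = k
    · simp [hjk]
    · rw [if_neg hjk, if_neg (Ne.symm hjk), mul_zero]
  simp_rw [hv]
  exact tsum_ite_eq k _

lemma fourierCoeff_conv_phi {lam : ℝ → ℝ} (hs : Summable fun j : ℤ => |lam j|) {G : Torus → ℂ}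
    (hG : Integrable G circleMeasure) (k : ℤ) :
    fourierCoeff (conv (phi lam) G) k = lam k * fourierCoeff G k := by
  have h : conv (phi lam) G = fun x => ∑' j : ℤ, ((lam j : ℂ) * fourierCoeff G j) * fourier j x :=
    funext fun x => conv_trigSeries hs hG x
  rw [h, fourierCoeff_tsum]
  refine (hs.mul_right (∫ t, ‖G t‖ ∂circleMeasure)).of_nonneg_of_le (fun _ => norm_nonneg _)
    fun j => ?_
  rw [norm_mul, Complex.norm_real, Real.norm_eq_abs]
  gcongr
  exact norm_fourierCoeff_le j

lemma density_spec {lam : ℝ → ℝ} {G : Torus → ℂ} (hG : Integrable G circleMeasure) :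
    Integrable (density lam (conv (phi lam) G)) circleMeasure ∧
      conv (phi lam) G = conv (phi lam) (density lam (conv (phi lam) G)) := by
  have h : ∃ g : Torus → ℂ, Integrable g circleMeasure ∧ conv (phi lam) G = conv (phi lam) g :=
    ⟨G, hG, rfl⟩
  rw [density, dif_pos h]
  exact h.choose_spec

/-- `density` is a choice and need not return `G`, but both have the same convolution with `phi
lam`. Dividing the Fourier coefficients by `lam k ≠ 0` shows that theirs agree, and nothing more is
needed. -/
lemma conv_trigSeries_density {lam : ℝ → ℝ} (hs : Summable fun j : ℤ => |lam j|)
    (hlam0 : ∀ t, lam t ≠ 0) {a : ℤ → ℝ} (ha : Summable fun j => |a j|) {G : Torus → ℂ}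
    (hG : Integrable G circleMeasure) :
    conv (trigSeries a) (density lam (conv (phi lam) G)) = conv (trigSeries a) G := by
  obtain ⟨hd, he⟩ := density_spec (lam := lam) hG
  have hc : ∀ k : ℤ, fourierCoeff (density lam (conv (phi lam) G)) k = fourierCoeff G k := fun k => by
    have h1 := fourierCoeff_conv_phi hs hG k
    have h2 := fourierCoeff_conv_phi hs hd k
    rw [← he, h1] at h2
    exact (mul_left_cancel₀ (Complex.ofReal_ne_zero.2 (hlam0 k)) h2).symm
  funext x
  rw [conv_trigSeries ha hd, conv_trigSeries ha hG]
  simp_rw [hc]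

lemma kernelH_eq {θ lam : ℝ → ℝ} (hlam0 : ∀ t, lam t ≠ 0) (m : ℕ) :
    kernelH θ lam lam m = trigSeries fun j : ℤ => θ ((j : ℝ) / m) := by
  funext x
  refine tsum_congr fun j => ?_
  rw [div_self (hlam0 _), mul_one]

lemma continuous_kernelQ {θ lam : ℝ → ℝ} (hs : Summable fun j : ℤ => |lam j|) (hθ : IsCutoff θ)
    {m : ℕ} (hm : 1 ≤ m) : Continuous fun z : Torus × Torus => kernelQ θ lam m z.1 z.2 :=
  continuous_const.mul (continuous_finsetSum _ fun _ _ =>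
    ((continuous_trigSeries (summable_abs_of_vanish fun _ hj => cutoff_vanish hθ hm hj)).comp
      (continuous_const.sub continuous_snd)).mul
      ((continuous_trigSeries hs).comp (continuous_fst.sub continuous_const)))

lemma continuous_kernelQ_apply {θ lam : ℝ → ℝ} (hs : Summable fun j : ℤ => |lam j|)
    (hθ : IsCutoff θ) {m : ℕ} (hm : 1 ≤ m) (x : Torus) : Continuous (kernelQ θ lam m x) := by
  have h := (continuous_kernelQ hs hθ hm).comp (Continuous.prodMk_right x)
  exact h

lemma Continuous.integrable_mul {b G : Torus → ℂ} (hb : Continuous b)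
    (hG : Integrable G circleMeasure) : Integrable (fun t => b t * G t) circleMeasure := by
  obtain ⟨c, hc⟩ := (isCompact_univ (X := Torus)).exists_bound_of_continuousOn hb.continuousOn
  exact hG.bdd_mul hb.aestronglyMeasurable (ae_of_all _ fun t => hc t (Set.mem_univ t))

/-- On univariate functions `φ_lam * G`, the operator `opQ` is the integral operator with kernel
`kernelQ` applied to `G`. -/
lemma opQ_conv {θ lam : ℝ → ℝ} (hs : Summable fun j : ℤ => |lam j|) (hlam0 : ∀ t, lam t ≠ 0)
    (hθ : IsCutoff θ) {m : ℕ} (hm : 1 ≤ m) {G : Torus → ℂ} (hG : Integrable G circleMeasure)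
    (x : Torus) :
    opQ θ lam lam m (conv (phi lam) G) x = ∫ t, kernelQ θ lam m x t * G t ∂circleMeasure := by
  have ha : Summable fun j : ℤ => |θ ((j : ℝ) / m)| :=
    summable_abs_of_vanish fun j hj => cutoff_vanish hθ hm hj
  have hi : ∀ s, Integrable (fun t => trigSeries (fun j : ℤ => θ ((j : ℝ) / m)) (node m s - t) *
      G t) circleMeasure := fun s =>
    Continuous.integrable_mul ((continuous_trigSeries ha).comp (continuous_sub_left _)) hG
  rw [opQ, kernelH_eq hlam0, conv_trigSeries_density hs hlam0 ha hG]
  simp_rw [conv_eq_integral, ← integral_mul_const]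
  rw [← integral_finsetSum _ fun s _ => (hi s).mul_const _, ← integral_const_mul]
  refine integral_congr_ae (ae_of_all _ fun t => ?_)
  simp only [kernelQ]
  rw [mul_assoc, Finset.sum_mul]
  congr 1
  exact Finset.sum_congr rfl fun s _ => by ring

/-- The kernel of the operator `opq`. -/
def kernelq (θ lam : ℝ → ℝ) : ℕ → Torus → Torus → ℂ
  | 0 => kernelQ θ lam 1
  | k + 1 => fun x y => kernelQ θ lam (2 ^ (k + 1)) x y - kernelQ θ lam (2 ^ k) x y

lemma continuous_kernelq {θ lam : ℝ → ℝ} (hs : Summable fun j : ℤ => |lam j|) (hθ : IsCutoff θ)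
    (k : ℕ) : Continuous fun z : Torus × Torus => kernelq θ lam k z.1 z.2 := by
  cases k with
  | zero => exact continuous_kernelQ hs hθ le_rfl
  | succ k =>
    exact (continuous_kernelQ hs hθ (m := 2 ^ (k + 1)) Nat.one_le_two_pow).sub
      (continuous_kernelQ hs hθ (m := 2 ^ k) Nat.one_le_two_pow)

lemma opq_conv {θ lam : ℝ → ℝ} (hs : Summable fun j : ℤ => |lam j|) (hlam0 : ∀ t, lam t ≠ 0)
    (hθ : IsCutoff θ) (k : ℕ) {G : Torus → ℂ} (hG : Integrable G circleMeasure) (x : Torus) :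
    opq θ lam k (conv (phi lam) G) x = ∫ t, kernelq θ lam k x t * G t ∂circleMeasure := by
  cases k with
  | zero => exact opQ_conv hs hlam0 hθ le_rfl hG x
  | succ k =>
    have hc : ∀ k : ℕ, Continuous (kernelQ θ lam (2 ^ k) x) := fun k =>
      continuous_kernelQ_apply hs hθ Nat.one_le_two_pow x
    calc _ = opQ θ lam lam (2 ^ (k + 1)) (conv (phi lam) G) x -
          opQ θ lam lam (2 ^ k) (conv (phi lam) G) x := rfl
      _ = ∫ t, kernelQ θ lam (2 ^ (k + 1)) x t * G t ∂circleMeasure -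
          ∫ t, kernelQ θ lam (2 ^ k) x t * G t ∂circleMeasure := by
          rw [opQ_conv hs hlam0 hθ (m := 2 ^ (k + 1)) Nat.one_le_two_pow hG,
            opQ_conv hs hlam0 hθ (m := 2 ^ k) Nat.one_le_two_pow hG]
      _ = ∫ t, (kernelQ θ lam (2 ^ (k + 1)) x t * G t - kernelQ θ lam (2 ^ k) x t * G t)
          ∂circleMeasure := (integral_sub (Continuous.integrable_mul (hc _) hG)
            (Continuous.integrable_mul (hc _) hG)).symm
      _ = _ := integral_congr_ae (ae_of_all _ fun t => (sub_mul _ _ _).symm)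

/-! ### Estimates for the kernels -/

lemma IsMask.kernelErr_bound {r κ : ℝ} {lam θ : ℝ → ℝ} (h : IsMask r κ lam) (hr : 1 < r)
    (hκ : 0 ≤ κ) (hθ : IsCutoff θ) :
    ∃ C, 0 ≤ C ∧ ∀ m : ℕ, 1 ≤ m → SchurBound (kernelErr θ lam m) (C * rate r κ m) ∧
      (∀ x y, ‖kernelErr θ lam m x y‖ ≤ C * rate r κ m * m) ∧
      ∀ x y, kernelErr θ lam m x y = phi lam (x - y) - kernelQ θ lam m x y := by
  obtain ⟨B1, hB1, h1⟩ := h.coeffBound_highPart hr hκ hθ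
  obtain ⟨B2, hB2, h2⟩ := h.coeffBound_highPart hr hκ hθ.sq
  obtain ⟨A, hA⟩ := hθ.coeffBound
  have hA0 : 0 ≤ A := (hA 1 le_rfl).nonneg le_rfl
  refine ⟨6 * B2 + 36 * A * B1, by positivity, fun m hm => ⟨?_, fun x y => ?_, fun x y =>
    kernelErr_eq hθ hm (h1 m hm).summable (h2 m hm).summable x y⟩⟩
  · exact ((SchurBound.of_trigSeries (h2 m hm) hm).sub
      (SchurBound.of_mean (hA m hm) (h1 m hm) hm)).mono (by apply le_of_eq; ring)
  · have hR : 0 ≤ rate r κ m := by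
      have : 0 ≤ Real.log ((m : ℝ) + 2) :=
        Real.log_nonneg (by linarith [(Nat.cast_nonneg m : (0 : ℝ) ≤ m)])
      unfold rate; positivity
    have e1 := (norm_trigSeries_le (h2 m hm).summable (x - y)).trans (h2 m hm).sum_le
    have e2 := norm_mean_le (hA m hm) (h1 m hm) hm x y
    refine (norm_sub_le _ _).trans ((add_le_add e1 e2).trans ?_)
    have : 0 ≤ B2 * rate r κ m * m := by positivity
    have : 0 ≤ A * B1 * rate r κ m * m := by positivity
    nlinarith

/-- The decay `2^{-r k} (k + 2)^{-κ}`. -/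
def decay (r κ : ℝ) (k : ℕ) : ℝ := (2 : ℝ) ^ (-r * k) * ((k : ℝ) + 2) ^ (-κ)

lemma decay_pos (r κ : ℝ) (k : ℕ) : 0 < decay r κ k := by unfold decay; positivity

/-- The kernel with index `k + 1` involves both `m = 2^k` and `m = 2^(k+1)`, so the rate at `2^k` is
compared with the decay at `k` and at `k + 1`; the shift costs `2^r`. -/
lemma exists_rate_le (r : ℝ) {κ : ℝ} (hr : 0 ≤ r) (hκ : 0 ≤ κ) :
    ∃ c, 0 ≤ c ∧ ∀ k : ℕ, rate r κ (2 ^ k) ≤ c * decay r κ k ∧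
      rate r κ (2 ^ k) ≤ c * decay r κ (k + 1) := by
  have hl := Real.log_pos one_lt_two
  have key : ∀ k : ℕ, rate r κ (2 ^ k) ≤ (Real.log 2 / 4) ^ (-κ) *
      ((2 : ℝ) ^ (-r * k) * ((k : ℝ) + 3) ^ (-κ)) := fun k => by
    -- With `L = log (2^k + 2)`, add `k log 2 ≤ L` and three times `log 2 ≤ L`.
    have h1 : Real.log 2 / 4 * ((k : ℝ) + 3) ≤ Real.log (((2 ^ k : ℕ) : ℝ) + 2) := by
      have hlog1 : Real.log 2 ≤ Real.log (((2 ^ k : ℕ) : ℝ) + 2) :=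
        Real.log_le_log (by norm_num) (by linarith [(Nat.cast_nonneg (2 ^ k) : (0 : ℝ) ≤ _)])
      have hlogk : k * Real.log 2 ≤ Real.log (((2 ^ k : ℕ) : ℝ) + 2) := by
        rw [← Real.log_pow]
        exact Real.log_le_log (by positivity) (by push_cast; linarith)
      nlinarith
    have h2 : (((2 ^ k : ℕ) : ℝ)) ^ (-r) = (2 : ℝ) ^ (-r * k) := by
      push_cast
      rw [← Real.rpow_natCast, ← Real.rpow_mul zero_le_two]
      congr 1; ring
    rw [rate, h2]
    calc _ ≤ (2 : ℝ) ^ (-r * k) * (Real.log 2 / 4 * ((k : ℝ) + 3)) ^ (-κ) := by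
          refine mul_le_mul_of_nonneg_left ?_ (by positivity)
          exact Real.rpow_le_rpow_of_nonpos (by positivity) h1 (by linarith)
      _ = _ := by rw [Real.mul_rpow (by positivity) (by positivity)]; ring
  have h2r : (1 : ℝ) ≤ 2 ^ r := Real.one_le_rpow one_le_two hr
  have hc : 0 ≤ (Real.log 2 / 4) ^ (-κ) := by positivity
  refine ⟨(Real.log 2 / 4) ^ (-κ) * 2 ^ r, by positivity, fun k => ⟨(key k).trans ?_,
    (key k).trans ?_⟩⟩
  · rw [mul_assoc]
    refine mul_le_mul_of_nonneg_left ?_ hc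
    calc _ ≤ decay r κ k := by
          unfold decay
          refine mul_le_mul_of_nonneg_left ?_ (by positivity)
          exact Real.rpow_le_rpow_of_nonpos (by positivity) (by linarith) (by linarith)
      _ ≤ _ := le_mul_of_one_le_left (decay_pos r κ k).le h2r
  · rw [mul_assoc]
    refine mul_le_mul_of_nonneg_left (le_of_eq ?_) hc
    unfold decay
    rw [← mul_assoc, ← Real.rpow_add two_pos]
    push_cast
    congr 2 <;> ring

/-- For positive index the kernel is the difference of two consecutive error kernels, since `phi`
cancels. For index `0` it is `phi` minus an error kernel and a plain sup bound suffices. The last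
clause identifies the limit of the telescoping partial sums. -/
lemma IsMask.kernelq_bound {r κ : ℝ} {lam θ : ℝ → ℝ} (h : IsMask r κ lam) (hr : 1 < r)
    (hκ : 0 ≤ κ) (hθ : IsCutoff θ) :
    ∃ C, 0 < C ∧ ∀ k, SchurBound (kernelq θ lam k) (C * decay r κ k) ∧
      (∀ x y, ‖kernelq θ lam k x y‖ ≤ C * decay r κ k * 2 ^ k) ∧
      ∀ x y, ‖phi lam (x - y) - kernelQ θ lam (2 ^ k) x y‖ ≤ C * decay r κ k * 2 ^ k := by
  obtain ⟨C, hC, hE⟩ := h.kernelErr_bound hr hκ hθ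
  obtain ⟨c, hc, hrate⟩ := exists_rate_le r (by linarith : 0 ≤ r) hκ
  have hs := h.summable hr hκ
  have hone : ∀ k : ℕ, 1 ≤ 2 ^ k := fun k => Nat.one_le_two_pow
  set S := ∑' j : ℤ, |lam j| with hS
  have hS0 : 0 ≤ S := tsum_nonneg fun _ => abs_nonneg _
  have hCc : 0 ≤ C * c := mul_nonneg hC hc
  have hd0 := decay_pos r κ 0
  -- The first summand serves the differences, the second the index `0`, where `‖phi‖ ≤ S`; the `1`
  -- makes `A` positive.
  set A := 2 * (C * c) + S / decay r κ 0 + 1 with hA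
  have hA0 : 0 < A := by positivity
  have hA1 : C * c ≤ A := by
    have : 0 ≤ S / decay r κ 0 := by positivity
    linarith
  have hA2 : 2 * (C * c) ≤ A := by
    have : 0 ≤ S / decay r κ 0 := by positivity
    linarith
  have hsup : ∀ k j : ℕ, rate r κ (2 ^ j) ≤ c * decay r κ k → j ≤ k → ∀ x y,
      ‖kernelErr θ lam (2 ^ j) x y‖ ≤ C * c * decay r κ k * 2 ^ k := fun k j hj hjk x y => by
    refine ((hE _ (hone j)).2.1 x y).trans ?_
    have hp : ((2 ^ j : ℕ) : ℝ) ≤ 2 ^ k := by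
      push_cast; exact pow_le_pow_right₀ one_le_two hjk
    have := decay_pos r κ k
    calc C * rate r κ (2 ^ j) * ((2 ^ j : ℕ) : ℝ) ≤ C * (c * decay r κ k) * 2 ^ k := by gcongr
      _ = _ := by ring
  have hthird : ∀ k x y, ‖phi lam (x - y) - kernelQ θ lam (2 ^ k) x y‖ ≤
      A * decay r κ k * 2 ^ k := fun k x y => by
    rw [← (hE _ (hone k)).2.2]
    refine (hsup k k (hrate k).1 le_rfl x y).trans ?_
    have := decay_pos r κ k
    gcongr
  refine ⟨A, hA0, fun k => ?_⟩
  cases k with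
  | zero =>
    have hn : ∀ x y, ‖kernelq θ lam 0 x y‖ ≤ A * decay r κ 0 := fun x y => by
      have e : kernelq θ lam 0 x y = phi lam (x - y) - kernelErr θ lam (2 ^ 0) x y := by
        rw [(hE _ (hone 0)).2.2]; simp [kernelq]
      rw [e]
      refine (norm_sub_le _ _).trans ((add_le_add (norm_trigSeries_le hs _)
        (hsup 0 0 (hrate 0).1 le_rfl x y)).trans ?_)
      rw [← hS, hA, pow_zero, mul_one, add_mul, add_mul, div_mul_cancel₀ _ hd0.ne']
      nlinarith
    refine ⟨SchurBound.of_norm_le (continuous_kernelq hs hθ 0) hn, fun x y => ?_, hthird 0⟩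
    simpa using hn x y
  | succ k =>
    have e : ∀ x y, kernelq θ lam (k + 1) x y =
        kernelErr θ lam (2 ^ k) x y - kernelErr θ lam (2 ^ (k + 1)) x y := fun x y => by
      rw [(hE _ (hone k)).2.2, (hE _ (hone (k + 1))).2.2]; simp [kernelq]
    have hd := decay_pos r κ (k + 1)
    refine ⟨?_, fun x y => ?_, hthird (k + 1)⟩
    · have e' : kernelq θ lam (k + 1) = fun x y =>
          kernelErr θ lam (2 ^ k) x y - kernelErr θ lam (2 ^ (k + 1)) x y :=
        funext fun x => funext fun y => e x y
      rw [e']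
      refine ((hE _ (hone k)).1.sub (hE _ (hone (k + 1))).1).mono ?_
      calc _ ≤ C * (c * decay r κ (k + 1)) + C * (c * decay r κ (k + 1)) := by
            gcongr
            · exact (hrate k).2
            · exact (hrate (k + 1)).1
        _ = 2 * (C * c) * decay r κ (k + 1) := by ring
        _ ≤ _ := by gcongr
    · rw [e]
      refine (norm_sub_le _ _).trans ((add_le_add (hsup (k + 1) k (hrate k).2 (by omega) x y)
        (hsup (k + 1) (k + 1) (hrate (k + 1)).1 le_rfl x y)).trans ?_)
      calc _ = 2 * (C * c) * decay r κ (k + 1) * 2 ^ (k + 1) := by ring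
        _ ≤ _ := by gcongr

lemma summable_decay {r κ : ℝ} (hr : 1 < r) (hκ : 0 ≤ κ) (C : ℝ) :
    Summable fun k : ℕ => C * decay r κ k * 2 ^ k := by
  have hg : Summable fun k : ℕ => ((2 : ℝ) ^ (1 - r)) ^ k :=
    summable_geometric_of_lt_one (by positivity)
      (Real.rpow_lt_one_of_one_lt_of_neg one_lt_two (by linarith))
  have h1 : Summable fun k : ℕ => decay r κ k * 2 ^ k := by
    refine hg.of_nonneg_of_le (fun k => (mul_pos (decay_pos r κ k) (by positivity)).le) fun k => ?_
    have e : ((2 : ℝ) ^ (1 - r)) ^ k = (2 : ℝ) ^ (-r * k) * 2 ^ k := by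
      rw [← Real.rpow_natCast, ← Real.rpow_mul zero_le_two, ← Real.rpow_natCast 2 k,
        ← Real.rpow_add two_pos]
      congr 1; ring
    rw [e]
    refine mul_le_mul_of_nonneg_right ?_ (by positivity)
    refine mul_le_of_le_one_right (by positivity) ?_
    exact Real.rpow_le_one_of_one_le_of_nonpos (by linarith [(Nat.cast_nonneg k : (0 : ℝ) ≤ k)])
      (by linarith)
  simpa only [mul_assoc] using h1.mul_left C

/-- The kernels of the operators `opq` sum up to that of the identity. -/
lemma IsMask.hasSum_kernelq {r κ : ℝ} {lam θ : ℝ → ℝ} (h : IsMask r κ lam) (hr : 1 < r)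
    (hκ : 0 ≤ κ) (hθ : IsCutoff θ) (x y : Torus) :
    HasSum (fun k => kernelq θ lam k x y) (phi lam (x - y)) := by
  obtain ⟨C, hC, hb⟩ := h.kernelq_bound hr hκ hθ
  have hs := summable_decay hr hκ C
  have hsum : Summable fun k => kernelq θ lam k x y :=
    Summable.of_norm (hs.of_nonneg_of_le (fun _ => norm_nonneg _) fun k => (hb k).2.1 x y)
  rw [hsum.hasSum_iff_tendsto_nat, ← tendsto_add_atTop_iff_nat 1]
  have hp : ∀ n, ∑ k ∈ Finset.range (n + 1), kernelq θ lam k x y = kernelQ θ lam (2 ^ n) x y := by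
    intro n
    induction n with
    | zero => simp [kernelq]
    | succ n ih => rw [Finset.sum_range_succ, ih]; simp [kernelq]
  simp_rw [hp]
  rw [tendsto_iff_norm_sub_tendsto_zero]
  refine squeeze_zero (fun _ => norm_nonneg _) (fun n => ?_) hs.tendsto_atTop_zero
  rw [norm_sub_rev]
  exact (hb n).2.2 x y

/-! ### The Schur test -/

section Schur

variable {X : Type*} [MeasurableSpace X] {μ : Measure X}

/-- Hölder's inequality for the factorization `k u = (k^{1/P} u) · k^{1/q}` with `q` conjugate to
`P`. -/
lemma lintegral_mul_rpow_le {k u : X → ℝ≥0∞} (hk : AEMeasurable k μ) (hu : AEMeasurable u μ)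
    {P : ℝ} (hP : 1 ≤ P) :
    (∫⁻ y, k y * u y ∂μ) ^ P ≤ (∫⁻ y, k y ∂μ) ^ (P - 1) * ∫⁻ y, k y * u y ^ P ∂μ := by
  rcases hP.eq_or_lt with rfl | hP1
  · simp
  have hP0 : 0 < P := by linarith
  have hpq : P.HolderConjugate P.conjExponent := Real.HolderConjugate.conjExponent hP1
  set q := P.conjExponent with hq
  have hsum : 1 / P + 1 / q = 1 := by
    have := hpq.inv_add_inv_eq_one
    simpa only [one_div] using this
  have h := ENNReal.lintegral_mul_le_Lp_mul_Lq μ hpq (f := fun y => k y ^ (1 / P) * u y)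
    (g := fun y => k y ^ (1 / q)) ((hk.pow_const _).mul hu) (hk.pow_const _)
  have hq0 : 0 < q := hpq.symm.pos
  have e1 : ∀ y, ((fun y => k y ^ (1 / P) * u y) * fun y => k y ^ (1 / q)) y = k y * u y :=
    fun y => by
      simp only [Pi.mul_apply]
      rw [mul_right_comm, ← ENNReal.rpow_add_of_nonneg _ _ (by positivity) (by positivity), hsum,
        ENNReal.rpow_one]
  have e2 : ∀ y, (k y ^ (1 / P) * u y) ^ P = k y * u y ^ P := fun y => by
    rw [ENNReal.mul_rpow_of_nonneg _ _ hP0.le, ← ENNReal.rpow_mul, one_div_mul_cancel hP0.ne',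
      ENNReal.rpow_one]
  have e3 : ∀ y, (k y ^ (1 / q)) ^ q = k y := fun y => by
    rw [← ENNReal.rpow_mul, one_div_mul_cancel hq0.ne', ENNReal.rpow_one]
  simp_rw [e1, e2, e3] at h
  calc _ ≤ ((∫⁻ y, k y * u y ^ P ∂μ) ^ (1 / P) * (∫⁻ y, k y ∂μ) ^ (1 / q)) ^ P :=
        ENNReal.rpow_le_rpow h hP0.le
    _ = _ := by
        rw [ENNReal.mul_rpow_of_nonneg _ _ hP0.le, ← ENNReal.rpow_mul, ← ENNReal.rpow_mul,
          one_div_mul_cancel hP0.ne', ENNReal.rpow_one, mul_comm]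
        congr 2
        have : 1 / q = 1 - 1 / P := by linarith
        rw [this, sub_mul, one_mul, one_div_mul_cancel hP0.ne']

/-- Schur's test. For finite `p`, Hölder in `y` and the row bound give `A^{P-1}`, and the column
bound gives the last factor `A` after Tonelli; for `p = ∞` the row bound is enough. -/
lemma eLpNorm_integral_mul_le [SFinite μ] {K : X → X → ℂ} (hK : Measurable (Function.uncurry K))
    {A : ℝ≥0∞} (hl : ∀ x, ∫⁻ y, ‖K x y‖ₑ ∂μ ≤ A) (hr : ∀ y, ∫⁻ x, ‖K x y‖ₑ ∂μ ≤ A)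
    {g : X → ℂ} (hg : AEStronglyMeasurable g μ) {p : ℝ≥0∞} (hp : 1 ≤ p) :
    eLpNorm (fun x => ∫ y, K x y * g y ∂μ) p μ ≤ A * eLpNorm g p μ := by
  have hpt : ∀ x, ‖∫ y, K x y * g y ∂μ‖ₑ ≤ ∫⁻ y, ‖K x y‖ₑ * ‖g y‖ₑ ∂μ := fun x =>
    (enorm_integral_le_lintegral_enorm _).trans_eq (by simp_rw [enorm_mul])
  have hKx : ∀ x, Measurable fun y => ‖K x y‖ₑ := fun x =>
    (hK.comp measurable_prodMk_left).enorm
  have hKy : ∀ y, Measurable fun x => ‖K x y‖ₑ := fun y =>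
    (hK.comp measurable_prodMk_right).enorm
  rcases eq_or_ne p ⊤ with rfl | hpt'
  · rw [eLpNorm_exponent_top, eLpNorm_exponent_top]
    refine eLpNormEssSup_le_of_ae_enorm_bound (ae_of_all _ fun x => (hpt x).trans ?_)
    calc _ ≤ ∫⁻ y, ‖K x y‖ₑ * eLpNormEssSup g μ ∂μ := by
          refine lintegral_mono_ae ?_
          filter_upwards [enorm_ae_le_eLpNormEssSup g μ] with y hy
          gcongr
      _ = (∫⁻ y, ‖K x y‖ₑ ∂μ) * eLpNormEssSup g μ := lintegral_mul_const _ (hKx x)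
      _ ≤ _ := by gcongr; exact hl x
  have hp0 : p ≠ 0 := (zero_lt_one.trans_le hp).ne'
  set P := p.toReal with hP
  have hP1 : 1 ≤ P := by
    rw [hP, ← ENNReal.toReal_one]; exact ENNReal.toReal_mono hpt' hp
  have hP0 : 0 < P := by linarith
  rw [eLpNorm_eq_lintegral_rpow_enorm_toReal hp0 hpt', eLpNorm_eq_lintegral_rpow_enorm_toReal hp0 hpt',
    ← hP]
  have key : ∫⁻ x, ‖∫ y, K x y * g y ∂μ‖ₑ ^ P ∂μ ≤ A ^ P * ∫⁻ y, ‖g y‖ₑ ^ P ∂μ := by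
    have hgP : AEMeasurable (fun y => ‖g y‖ₑ ^ P) μ := hg.enorm.pow_const _
    have hm : AEMeasurable (Function.uncurry fun x y => ‖K x y‖ₑ * ‖g y‖ₑ ^ P) (μ.prod μ) :=
      hK.enorm.aemeasurable.mul (hgP.comp_quasiMeasurePreserving
        Measure.quasiMeasurePreserving_snd)
    calc _ ≤ ∫⁻ x, A ^ (P - 1) * ∫⁻ y, ‖K x y‖ₑ * ‖g y‖ₑ ^ P ∂μ ∂μ := by
          refine lintegral_mono fun x => ?_
          refine (ENNReal.rpow_le_rpow (hpt x) hP0.le).trans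
            ((lintegral_mul_rpow_le (hKx x).aemeasurable hg.enorm hP1).trans ?_)
          exact mul_le_mul_left (ENNReal.rpow_le_rpow (hl x) (by linarith)) _
      _ = A ^ (P - 1) * ∫⁻ x, ∫⁻ y, ‖K x y‖ₑ * ‖g y‖ₑ ^ P ∂μ ∂μ :=
          lintegral_const_mul'' _ hm.lintegral_prod_right'
      _ = A ^ (P - 1) * ∫⁻ y, ∫⁻ x, ‖K x y‖ₑ * ‖g y‖ₑ ^ P ∂μ ∂μ := by
          rw [lintegral_lintegral_swap hm]
      _ ≤ A ^ (P - 1) * ∫⁻ y, A * ‖g y‖ₑ ^ P ∂μ := by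
          gcongr with y
          rw [lintegral_mul_const _ (hKy y)]
          gcongr
          exact hr y
      _ = A ^ (P - 1) * (A * ∫⁻ y, ‖g y‖ₑ ^ P ∂μ) := by rw [lintegral_const_mul'' _ hgP]
      _ = A ^ P * ∫⁻ y, ‖g y‖ₑ ^ P ∂μ := by
          rw [← mul_assoc]
          congr 1
          conv_lhs => rw [← ENNReal.rpow_one A, ← ENNReal.rpow_mul, one_mul]
          rw [← ENNReal.rpow_add_of_nonneg _ _ (by linarith) zero_le_one, sub_add_cancel]
  calc _ ≤ (A ^ P * ∫⁻ y, ‖g y‖ₑ ^ P ∂μ) ^ (1 / P) := ENNReal.rpow_le_rpow key (by positivity)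
    _ = _ := by
        rw [ENNReal.mul_rpow_of_nonneg _ _ (by positivity), ← ENNReal.rpow_mul,
          mul_one_div_cancel hP0.ne', ENNReal.rpow_one]

end Schur

/-! ### Product kernels on the multivariate torus -/

/-- Induction on `d`, splitting off the first coordinate. It serves both to factor `phiMulti` and to
sum the product kernels. -/
lemma hasSum_pi_prod {ι : Type*} {d : ℕ} {f : Fin d → ι → ℂ} {s : Fin d → ℂ}
    (hf : ∀ l, Summable fun i => ‖f l i‖) (hs : ∀ l, HasSum (f l) (s l)) :
    (Summable fun j : Fin d → ι => ‖∏ l, f l (j l)‖) ∧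
      HasSum (fun j : Fin d → ι => ∏ l, f l (j l)) (∏ l, s l) := by
  induction d with
  | zero =>
    simp only [Finset.univ_eq_empty, Finset.prod_empty]
    exact ⟨(hasSum_unique _).summable, hasSum_unique fun _ : Fin 0 → ι => (1 : ℂ)⟩
  | succ d ih =>
    obtain ⟨h1, h2⟩ := ih (fun l => hf (Fin.succ l)) (fun l => hs (Fin.succ l))
    have e : ∀ z : ι × (Fin d → ι), ∏ l, f l (Fin.consEquiv (fun _ => ι) z l) =
        f 0 z.1 * ∏ l : Fin d, f l.succ (z.2 l) := fun z => by
      rw [Fin.prod_univ_succ]; simp [Fin.consEquiv]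
    have hn := (hf 0).mul_norm h1
    rw [← (Fin.consEquiv fun _ => ι).summable_iff, ← (Fin.consEquiv fun _ => ι).hasSum_iff,
      Fin.prod_univ_succ]
    simp only [Function.comp_def, e]
    have hn' : Summable fun z : ι × (Fin d → ι) => f 0 z.1 * ∏ l : Fin d, f l.succ (z.2 l) :=
      hn.of_norm
    refine ⟨hn, ?_⟩
    exact HasSum.mul (f := f 0) (g := fun j : Fin d → ι => ∏ l : Fin d, f l.succ (j l))
      (hs 0) h2 hn'

lemma phiMulti_eq_prod {d : ℕ} {lam : ℝ → ℝ} (hs : Summable fun j : ℤ => |lam j|)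
    (x : Fin d → Torus) : phiMulti d lam x = ∏ l, phi lam (x l) := by
  have h := hasSum_pi_prod (f := fun (l : Fin d) (j : ℤ) => (lam j : ℂ) * fourier j (x l))
    (fun l => by simpa only [norm_coeff_mul_fourier (fun j : ℤ => lam j)] using hs)
    (fun l => (summable_trigSeries hs (x l)).hasSum)
  simp only [Finset.prod_mul_distrib] at h
  exact h.2.tsum_eq

/-- The integral operator on `d`-variate functions whose kernel is the product of the univariate
kernels `M l`. -/
def integralOp {d : ℕ} (M : Fin d → Torus → Torus → ℂ) (g : (Fin d → Torus) → ℂ)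
    (x : Fin d → Torus) : ℂ :=
  ∫ y, (∏ l, M l (x l) (y l)) * g y ∂torusMeasure d

instance (d : ℕ) : IsProbabilityMeasure (torusMeasure d) := by
  unfold torusMeasure; infer_instance

instance (d : ℕ) : (torusMeasure d).IsNegInvariant := by
  unfold torusMeasure; exact Measure.pi.isNegInvariant _

instance (d : ℕ) : (torusMeasure d).IsAddLeftInvariant := by
  unfold torusMeasure; infer_instance

lemma convMulti_phiMulti {d : ℕ} {lam : ℝ → ℝ} (hs : Summable fun j : ℤ => |lam j|)
    (g : (Fin d → Torus) → ℂ) :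
    convMulti (phiMulti d lam) g = integralOp (fun _ x y => phi lam (x - y)) g := by
  funext x
  have h : convMulti (phiMulti d lam) g x =
      ∫ t, phiMulti d lam (x - t) * g t ∂torusMeasure d := convolution_mul_swap
  rw [h]
  refine integral_congr_ae (ae_of_all _ fun t => ?_)
  simp only [phiMulti_eq_prod hs, Pi.sub_apply]

/-- Continuity of a univariate kernel in both variables. -/
def ContKernel (K : Torus → Torus → ℂ) : Prop := Continuous fun z : Torus × Torus => K z.1 z.2

lemma contKernel_phi {lam : ℝ → ℝ} (hs : Summable fun j : ℤ => |lam j|) :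
    ContKernel fun x y => phi lam (x - y) :=
  (continuous_trigSeries hs).comp (continuous_fst.sub continuous_snd)

lemma continuous_prod_kernel {d : ℕ} {M : Fin d → Torus → Torus → ℂ} (hM : ∀ l, ContKernel (M l)) :
    Continuous fun z : (Fin d → Torus) × (Fin d → Torus) => ∏ l, M l (z.1 l) (z.2 l) := by
  refine continuous_finsetProd _ fun l _ => ?_
  have h1 : Continuous fun z : Torus × Torus => M l z.1 z.2 := hM l
  have h2 : Continuous fun z : (Fin d → Torus) × (Fin d → Torus) => (z.1 l, z.2 l) := by fun_prop
  exact h1.comp h2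

lemma exists_prod_kernel_bound {d : ℕ} {M : Fin d → Torus → Torus → ℂ}
    (hM : ∀ l, ContKernel (M l)) : ∃ c, ∀ x y : Fin d → Torus, ‖∏ l, M l (x l) (y l)‖ ≤ c := by
  obtain ⟨c, hc⟩ := (isCompact_univ (X := (Fin d → Torus) × (Fin d → Torus))).exists_bound_of_continuousOn
    (continuous_prod_kernel hM).continuousOn
  exact ⟨c, fun x y => hc (x, y) (Set.mem_univ _)⟩

lemma integrable_prod_kernel_mul {d : ℕ} {M : Fin d → Torus → Torus → ℂ}
    (hM : ∀ l, ContKernel (M l)) {g : (Fin d → Torus) → ℂ} (hg : Integrable g (torusMeasure d))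
    (x : Fin d → Torus) :
    Integrable (fun y => (∏ l, M l (x l) (y l)) * g y) (torusMeasure d) := by
  obtain ⟨c, hc⟩ := exists_prod_kernel_bound hM
  refine hg.bdd_mul ?_ (ae_of_all _ fun y => hc x y)
  exact ((continuous_prod_kernel hM).comp (Continuous.prodMk_right x)).aestronglyMeasurable

lemma continuous_integralOp {d : ℕ} {M : Fin d → Torus → Torus → ℂ}
    (hM : ∀ l, ContKernel (M l)) {g : (Fin d → Torus) → ℂ} (hg : Integrable g (torusMeasure d)) :
    Continuous (integralOp M g) := by
  obtain ⟨c, hc⟩ := exists_prod_kernel_bound hM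
  refine continuous_of_dominated (bound := fun y => c * ‖g y‖)
    (fun x => (integrable_prod_kernel_mul hM hg x).aestronglyMeasurable)
    (fun x => ae_of_all _ fun y => ?_) (hg.norm.const_mul c) (ae_of_all _ fun y => ?_)
  · rw [norm_mul]
    gcongr
    exact hc x y
  · exact ((continuous_prod_kernel hM).comp (Continuous.prodMk_left y)).mul continuous_const

lemma memLp_of_continuous {d : ℕ} {f : (Fin d → Torus) → ℂ} (hf : Continuous f) (p : ℝ≥0∞) :
    MemLp f p (torusMeasure d) := by
  obtain ⟨c, hc⟩ := (isCompact_univ (X := Fin d → Torus)).exists_bound_of_continuousOn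
    hf.continuousOn
  exact MemLp.of_bound hf.aestronglyMeasurable c (ae_of_all _ fun x => hc x (Set.mem_univ x))

lemma lintegral_enorm_prod_le {d : ℕ} {N : Fin d → Torus → ℂ} {A : Fin d → ℝ}
    (hN : ∀ l, Continuous (N l)) (hA : ∀ l, ∫ t, ‖N l t‖ ∂circleMeasure ≤ A l) :
    ∫⁻ y, ‖∏ l, N l (y l)‖ₑ ∂torusMeasure d ≤ ENNReal.ofReal (∏ l, A l) := by
  have hc : Continuous fun y : Fin d → Torus => ∏ l, N l (y l) :=
    continuous_finsetProd _ fun l _ => (hN l).comp (continuous_apply l)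
  have hi : Integrable (fun y : Fin d → Torus => ∏ l, N l (y l)) (torusMeasure d) :=
    memLp_one_iff_integrable.1 (memLp_of_continuous hc 1)
  rw [← ofReal_integral_norm_eq_lintegral_enorm hi]
  refine ENNReal.ofReal_le_ofReal ?_
  have h : ∫ y, ‖∏ l, N l (y l)‖ ∂torusMeasure d = ∏ l, ∫ t, ‖N l t‖ ∂circleMeasure := by
    simp_rw [norm_prod]
    exact integral_fintype_prod_eq_prod (fun l t => ‖N l t‖)
  rw [h]
  exact Finset.prod_le_prod (fun l _ => integral_nonneg fun _ => norm_nonneg _) fun l _ => hA l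

lemma SchurBound.eLpNorm_integralOp_le {d : ℕ} {M : Fin d → Torus → Torus → ℂ} {A : Fin d → ℝ}
    (h : ∀ l, SchurBound (M l) (A l)) {g : (Fin d → Torus) → ℂ}
    (hg : AEStronglyMeasurable g (torusMeasure d)) {p : ℝ≥0∞} (hp : 1 ≤ p) :
    eLpNorm (integralOp M g) p (torusMeasure d) ≤
      ENNReal.ofReal (∏ l, A l) * eLpNorm g p (torusMeasure d) := by
  have hc := continuous_prod_kernel fun l => (h l).cont
  have hm : Measurable (Function.uncurry fun x y : Fin d → Torus => ∏ l, M l (x l) (y l)) :=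
    hc.measurable
  have hl : ∀ x : Fin d → Torus, ∫⁻ y, ‖∏ l, M l (x l) (y l)‖ₑ ∂torusMeasure d ≤
      ENNReal.ofReal (∏ l, A l) := fun x =>
    lintegral_enorm_prod_le (N := fun l => M l (x l)) (fun l => (h l).cont_left _)
      fun l => (h l).left _
  have hr : ∀ y : Fin d → Torus, ∫⁻ x, ‖∏ l, M l (x l) (y l)‖ₑ ∂torusMeasure d ≤
      ENNReal.ofReal (∏ l, A l) := fun y =>
    lintegral_enorm_prod_le (N := fun l t => M l t (y l)) (fun l => (h l).cont_right _)
      fun l => (h l).right _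
  exact eLpNorm_integral_mul_le hm hl hr hg hp

/-! ### Univariate operators acting on multivariate functions -/

/-- `G` is `W` integrated over all variables but the `j`-th, and the identity is Fubini's theorem.
-/
lemma exists_marginal {d : ℕ} (j : Fin d) {W : (Fin d → Torus) → ℂ}
    (hW : Integrable W (torusMeasure d)) :
    ∃ G : Torus → ℂ, Integrable G circleMeasure ∧ ∀ b : Torus → ℂ, Continuous b →
      ∫ y, b (y j) * W y ∂torusMeasure d = ∫ t, b t * G t ∂circleMeasure := by
  cases d with
  | zero => exact j.elim0
  | succ n =>
    set e := MeasurableEquiv.piFinSuccAbove (fun _ : Fin (n + 1) => Torus) j with he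
    have hmp : MeasurePreserving e (torusMeasure (n + 1)) (circleMeasure.prod (torusMeasure n)) :=
      measurePreserving_piFinSuccAbove (fun _ : Fin (n + 1) => circleMeasure) j
    have hint : ∀ V : (Fin (n + 1) → Torus) → ℂ, Integrable V (torusMeasure (n + 1)) →
        Integrable (fun z => V (e.symm z)) (circleMeasure.prod (torusMeasure n)) := fun V hV =>
      (hmp.symm.integrable_comp_emb e.symm.measurableEmbedding).2 hV
    refine ⟨fun t => ∫ z, W (e.symm (t, z)) ∂torusMeasure n, (hint W hW).integral_prod_left,
      fun b hb => ?_⟩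
    obtain ⟨c, hc⟩ := (isCompact_univ (X := Torus)).exists_bound_of_continuousOn hb.continuousOn
    have hbW : Integrable (fun y => b (y j) * W y) (torusMeasure (n + 1)) :=
      hW.bdd_mul (hb.comp (continuous_apply j)).aestronglyMeasurable
        (ae_of_all _ fun y => hc _ (Set.mem_univ _))
    rw [← hmp.symm.integral_comp', integral_prod _ (hint _ hbW)]
    refine integral_congr_ae (ae_of_all _ fun t => ?_)
    simp only
    rw [← integral_const_mul]
    refine integral_congr_ae (ae_of_all _ fun z => ?_)
    simp [he, MeasurableEquiv.piFinSuccAbove, Fin.insertNthEquiv]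

/-- With the other coordinates of `x` frozen, the function of the `j`-th variable is `φ_λ * G`,
where `G` is the marginal of `g` times the remaining kernels. This `G` is integrable for every `x`,
so `opq_conv` applies pointwise. -/
lemma applyAt_integralOp {d : ℕ} {θ lam : ℝ → ℝ} (hs : Summable fun j : ℤ => |lam j|)
    (hlam0 : ∀ t, lam t ≠ 0) (hθ : IsCutoff θ) {M : Fin d → Torus → Torus → ℂ}
    (hM : ∀ l, ContKernel (M l)) {g : (Fin d → Torus) → ℂ} (hg : Integrable g (torusMeasure d))
    {j : Fin d} (hj : M j = fun x y => phi lam (x - y)) (k : ℕ) :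
    applyAt (opq θ lam k) j (integralOp M g) =
      integralOp (Function.update M j (kernelq θ lam k)) g := by
  funext x
  -- The constant kernel `1` in position `j` removes that factor from the product.
  set W : (Fin d → Torus) → ℂ := fun y => (∏ l, Function.update M j (fun _ _ => 1) l (x l) (y l)) * g y
    with hWdef
  have hM1 : ∀ l, ContKernel (Function.update M j (fun _ _ => 1) l) := fun l => by
    by_cases h : l = j
    · subst h; rw [Function.update_self]; exact continuous_const
    · rw [Function.update_of_ne h]; exact hM l
  have hW : Integrable W (torusMeasure d) := integrable_prod_kernel_mul hM1 hg x
  obtain ⟨G, hG, hGW⟩ := exists_marginal j hW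
  have hsplit : ∀ (N : Torus → Torus → ℂ) (t : Torus), Continuous (N t) →
      integralOp (Function.update M j N) g (Function.update x j t) =
        ∫ s, N t s * G s ∂circleMeasure := fun N t hN => by
    rw [← hGW _ hN]
    refine integral_congr_ae (ae_of_all _ fun y => ?_)
    simp only [hWdef]
    rw [← mul_assoc]
    congr 1
    rw [← Finset.mul_prod_erase _ _ (Finset.mem_univ j), ← Finset.mul_prod_erase _ (fun l =>
      Function.update M j (fun _ _ => 1) l (x l) (y l)) (Finset.mem_univ j)]
    simp only [Function.update_self, one_mul]
    congr 1
    refine Finset.prod_congr rfl fun l hl => ?_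
    have hlj := Finset.ne_of_mem_erase hl
    rw [Function.update_of_ne hlj, Function.update_of_ne hlj, Function.update_of_ne hlj]
  have hu : (fun t => integralOp M g (Function.update x j t)) = conv (phi lam) G := by
    funext t
    have := hsplit (fun x y => phi lam (x - y)) t
      ((continuous_trigSeries hs).comp (continuous_sub_left t))
    rw [← hj, Function.update_eq_self] at this
    rw [this, conv_eq_integral]
  have hk := hsplit (kernelq θ lam k) (x j)
    ((continuous_kernelq hs hθ k).comp (Continuous.prodMk_right (x j)))
  rw [Function.update_eq_self] at hk
  rw [applyAt, hu, opq_conv hs hlam0 hθ k hG, hk]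

lemma opqMulti_eq_integralOp {d : ℕ} {θ lam : ℝ → ℝ} (hs : Summable fun j : ℤ => |lam j|)
    (hlam0 : ∀ t, lam t ≠ 0) (hθ : IsCutoff θ) {g : (Fin d → Torus) → ℂ}
    (hg : Integrable g (torusMeasure d)) (k : Fin d → ℕ) :
    opqMulti θ lam k (convMulti (phiMulti d lam) g) =
      integralOp (fun l => kernelq θ lam (k l)) g := by
  -- Variables already treated carry `kernelq`, the others still the kernel of the identity; `Nodup`
  -- ensures that the next variable is untreated.
  have key : ∀ L : List (Fin d), L.Nodup →
      L.foldr (fun j h => applyAt (opq θ lam (k j)) j h)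
        (integralOp (fun _ x y => phi lam (x - y)) g) =
      integralOp (fun l => if l ∈ L then kernelq θ lam (k l) else fun x y => phi lam (x - y)) g := by
    intro L
    induction L with
    | nil => intro _; simp
    | cons j L ih =>
      intro hnd
      rw [List.nodup_cons] at hnd
      rw [List.foldr_cons, ih hnd.2, applyAt_integralOp hs hlam0 hθ (fun l => ?_) hg (by
        rw [if_neg hnd.1])]
      · congr 1
        funext l
        by_cases h : l = j
        · subst h; simp
        · rw [Function.update_of_ne h]; simp [h]
      · split_ifs
        · exact continuous_kernelq hs hθ _
        · exact contKernel_phi hs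
  rw [convMulti_phiMulti hs, opqMulti, key _ (List.nodup_finRange d)]
  simp

/-- The product kernels are majorized by `∏ c (k l)`, summable over `k` and independent of `x, y`.
The error is at most the sum of this majorant outside `S` times `‖g‖₁`, and letting `S` run over all
finite sets gives unconditional convergence. -/
lemma IsMask.norm_sub_sum_le {d : ℕ} {r κ : ℝ} {lam θ : ℝ → ℝ} (h : IsMask r κ lam) (hr : 1 < r)
    (hκ : 0 ≤ κ) (hlam0 : ∀ t, lam t ≠ 0) (hθ : IsCutoff θ) {g : (Fin d → Torus) → ℂ}
    (hg : Integrable g (torusMeasure d)) :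
    ∃ ε : Finset (Fin d → ℕ) → ℝ, Tendsto ε atTop (𝓝 0) ∧ ∀ S x,
      ‖(convMulti (phiMulti d lam) g -
        ∑ k ∈ S, opqMulti θ lam k (convMulti (phiMulti d lam) g)) x‖ ≤ ε S := by
  have hs := h.summable hr hκ
  obtain ⟨C, hC, hb⟩ := h.kernelq_bound hr hκ hθ
  set c : ℕ → ℝ := fun k => C * decay r κ k * 2 ^ k with hc
  have hc0 : ∀ k, 0 ≤ c k := fun k => by
    have := decay_pos r κ k
    positivity
  have hcs : Summable c := summable_decay hr hκ C
  have hcC : Summable fun k => ‖(c k : ℂ)‖ := by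
    simpa [Complex.norm_real, abs_of_nonneg (hc0 _)] using hcs
  have hbs : Summable fun k : Fin d → ℕ => ∏ l, c (k l) := by
    have := (hasSum_pi_prod (d := d) (f := fun _ k => (c k : ℂ)) (fun _ => hcC)
      fun _ => hcC.of_norm.hasSum).1
    refine this.congr fun k => ?_
    rw [norm_prod]
    exact Finset.prod_congr rfl fun l _ => by
      rw [Complex.norm_real, Real.norm_eq_abs, abs_of_nonneg (hc0 _)]
  have hker : ∀ (S : Finset (Fin d → ℕ)) (x y : Fin d → Torus),
      ‖∏ l, phi lam (x l - y l) - ∑ k ∈ S, ∏ l, kernelq θ lam (k l) (x l) (y l)‖ ≤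
        ∑' k : { k // k ∉ S }, ∏ l, c (k.1 l) := fun S x y => by
    have hsum := hasSum_pi_prod (f := fun l k => kernelq θ lam k (x l) (y l))
      (fun l => hcs.of_nonneg_of_le (fun _ => norm_nonneg _) fun k => (hb k).2.1 (x l) (y l))
      fun l => h.hasSum_kernelq hr hκ hθ (x l) (y l)
    rw [← hsum.2.tsum_eq, ← hsum.2.summable.sum_add_tsum_compl (s := S), add_sub_cancel_left]
    refine tsum_of_norm_bounded (hbs.subtype _).hasSum fun k => ?_
    rw [norm_prod]
    exact Finset.prod_le_prod (fun _ _ => norm_nonneg _) fun l _ => (hb _).2.1 _ _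
  refine ⟨fun S => (∑' k : { k // k ∉ S }, ∏ l, c (k.1 l)) * ∫ y, ‖g y‖ ∂torusMeasure d, ?_,
    fun S x => ?_⟩
  · have := (tendsto_tsum_compl_atTop_zero fun k : Fin d → ℕ => ∏ l, c (k l)).mul_const
      (∫ y, ‖g y‖ ∂torusMeasure d)
    rwa [zero_mul] at this
  · have hi1 := integrable_prod_kernel_mul (fun _ => contKernel_phi hs) hg x
    have hi2 := fun k : Fin d → ℕ =>
      integrable_prod_kernel_mul (fun l => continuous_kernelq hs hθ (k l)) hg x
    have e : (convMulti (phiMulti d lam) g -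
        ∑ k ∈ S, opqMulti θ lam k (convMulti (phiMulti d lam) g)) x =
        ∫ y, (∏ l, phi lam (x l - y l) - ∑ k ∈ S, ∏ l, kernelq θ lam (k l) (x l) (y l)) * g y
          ∂torusMeasure d := by
      simp_rw [sub_mul, Finset.sum_mul]
      rw [integral_sub hi1 (integrable_finsetSum _ fun k _ => hi2 k),
        integral_finsetSum _ fun k _ => hi2 k, Pi.sub_apply, Finset.sum_apply]
      simp_rw [opqMulti_eq_integralOp hs hlam0 hθ hg]
      rw [convMulti_phiMulti hs]
      rfl
    simp only
    rw [e, ← integral_const_mul]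
    refine norm_integral_le_of_norm_le (hg.norm.const_mul _) (ae_of_all _ fun y => ?_)
    rw [norm_mul]
    gcongr
    exact hker S x y

end TranslateApprox

end

open TranslateApprox
theorem mainTheorem6 (d : ℕ) (p : ℝ≥0∞) (hp : 1 ≤ p) (r κ : ℝ) (hr : 1 < r) (hκ : 0 ≤ κ)
    (lam θ : ℝ → ℝ) (hlam : IsMask r κ lam) (hlam0 : ∀ t, lam t ≠ 0) (hθ : IsCutoff θ) :
    (∀ f ∈ spaceH d lam p,
      MemLp f p (torusMeasure d) ∧
      (∀ k : Fin d → ℕ, MemLp (opqMulti θ lam k f) p (torusMeasure d)) ∧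
      Tendsto (fun S : Finset (Fin d → ℕ) =>
          eLpNorm (f - ∑ k ∈ S, opqMulti θ lam k f) p (torusMeasure d)) atTop (𝓝 0)) ∧
    ∃ C : ℝ, 0 < C ∧ ∀ f ∈ spaceH d lam p, ∀ k : Fin d → ℕ,
      eLpNorm (opqMulti θ lam k f) p (torusMeasure d) ≤
        ENNReal.ofReal (C * (2 : ℝ) ^ (-r * ∑ j, (k j : ℝ)) * ∏ j, ((k j : ℝ) + 2) ^ (-κ)) *
          normH d lam p f := by
  have hs := hlam.summable hr hκ
  constructor
  · rintro f ⟨g, hg, rfl⟩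
    have hgi := hg.integrable hp
    refine ⟨?_, fun k => ?_, ?_⟩
    · rw [convMulti_phiMulti hs]
      exact memLp_of_continuous (continuous_integralOp (fun _ => contKernel_phi hs) hgi) p
    · rw [opqMulti_eq_integralOp hs hlam0 hθ hgi]
      exact memLp_of_continuous
        (continuous_integralOp (fun l => continuous_kernelq hs hθ (k l)) hgi) p
    · obtain ⟨ε, hε, hb⟩ := hlam.norm_sub_sum_le hr hκ hlam0 hθ hgi
      have h0 : Tendsto (fun S => ENNReal.ofReal (ε S)) atTop (𝓝 0) := by
        simpa using ENNReal.tendsto_ofReal hε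
      refine tendsto_of_tendsto_of_tendsto_of_le_of_le tendsto_const_nhds h0
        (fun _ => zero_le) fun S => ?_
      -- The measure has total mass one, so a uniform bound is an `L^p` bound for every `p`.
      refine (eLpNorm_le_of_ae_bound (ae_of_all _ (hb S))).trans ?_
      simp
  · obtain ⟨C, hC, hb⟩ := hlam.kernelq_bound hr hκ hθ
    -- One factor `C` for each variable.
    refine ⟨C ^ d, by positivity, fun f hf k => ?_⟩
    rw [normH, dif_pos hf]
    -- The estimate holds for any representing `g`, in particular for the one chosen in `normH`, so
    -- uniqueness of `g` plays no role.
    obtain ⟨hg, hfg⟩ := hf.choose_spec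
    set g := hf.choose
    rw [hfg, opqMulti_eq_integralOp hs hlam0 hθ (hg.integrable hp)]
    refine (SchurBound.eLpNorm_integralOp_le (fun l => (hb (k l)).1) hg.1 hp).trans_eq ?_
    congr 2
    unfold decay
    rw [Finset.prod_mul_distrib, Finset.prod_mul_distrib, Finset.prod_const, Finset.card_univ,
      Fintype.card_fin, Finset.mul_sum, Real.rpow_sum_of_pos two_pos, mul_assoc]
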